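/- Let $n\ge 1$, $p>1+\frac2n$, $K>0$, and let $f:\mathbb R\to\mathbb R$ satisfy $f(0)=0$ and $|f(\xi)-f(\eta)|\le K\,(|\xi|^{p-1}+|\eta|^{p-1})\,|\xi-\eta|$ for all $\xi,\eta\in\mathbb R$. Write $\|\cdot\|_q$ for the norm of $L^q(\mathbb R^n)$, let $e^{t\Delta}\varphi=G_t*\varphi$ for $t>0$, with $G_t(x)=(4\pi t)^{-n/2}e^{-|x|^2/(4t)}$, and $e^{0\Delta}\varphi=\varphi$, and let $$X=(C\cap L^\infty)\big([0,\infty);L^1(\mathbb R^n)\big)\cap (C\cap L^\infty)\big((0,\infty);L^\infty(\mathbb R^n)\big).$$ A global solution of $\partial_t u-\Delta u=f(u)$, $u(0)=\varphi$, in $X$ means a function $u\in X$ with $u(t)=e^{t\Delta}\varphi+\int_0^t e^{(t-s)\Delta}f(u(s))\,ds$ for all $t\ge 0$ (integrals of this kind are Bochner integrals in $L^1(\mathbb R^n)$). Then there is $\varepsilon_0>0$ such that for every $\varphi\in L^1(\mathbb R^n)\cap L^\infty(\mathbb R^n)$ with $\|\varphi\|_1+\|\varphi\|_\infty\le\varepsilon_0$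 there is a unique global solution $u\in X$; it satisfies $$\sup_{q\in[1,\infty]}\ \sup_{t\ge0}\ (1+t)^{\frac n2(1-\frac1q)}\|u(t)\|_q<\infty,$$ and the following holds. Put $\sigma=\frac n2(p-1)-1>0$ and define recursively $$\varphi_1=\varphi+\int_0^\infty f(u(s))\,ds,\qquad u_1(t)=e^{t\Delta}\varphi_1,$$ and, for $N\ge 2$, $$\varphi_N=\varphi+\int_0^\infty\big(f(u(s))-f(u_{N-1}(s))\big)\,ds,\qquad u_N(t)=e^{t\Delta}\varphi_N+\int_0^t e^{(t-s)\Delta}f(u_{N-1}(s))\,ds.$$ All these integrals converge in $L^1(\mathbb R^n)$ and $u_N(t)\in L^1(\mathbb R^n)\cap L^\infty(\mathbb R^n)$ for all $t>0$. Moreover, for every integer $N\ge1$ and every $q\in[1,\infty]$ there is a constant $C_{N,q}>0$ such that for all $t>2^{N-1}$ $$t^{\frac n2(1-\frac1q)}\,\|u(t)-u_N(t)\|_q\le\begin{cases}C_{N,q}\,t^{-N\sigma}&\text{if }0<N\sigma<1,\\ C_{N,q}\,t^{-1}\log(1+t)&\text{if }N\sigma=1,\\ C_{N,q}\,t^{-1}&\text{if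 }N\sigma>1.\end{cases}$$ -/

import Mathlib

open MeasureTheory Set

/-- The Euclidean space `ℝⁿ`. -/
abbrev RSp (n : ℕ) : Type := EuclideanSpace ℝ (Fin n)

/-- The real Lebesgue space `L¹(ℝⁿ)`. -/
abbrev L1Sp (n : ℕ) : Type := Lp ℝ 1 (volume : Measure (RSp n))

/-- The real Lebesgue space `L^∞(ℝⁿ)`. -/
abbrev LinfSp (n : ℕ) : Type := Lp ℝ ⊤ (volume : Measure (RSp n))

/-- The Gauss kernel `G_t(x) = (4πt)^{-n/2} exp(-|x|²/(4t))`. -/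
noncomputable def gaussKernel (n : ℕ) (t : ℝ) (x : RSp n) : ℝ :=
  (4 * Real.pi * t) ^ (-((n : ℝ) / 2)) * Real.exp (-(‖x‖ ^ 2 / (4 * t)))

theorem integrable_gaussKernel (n : ℕ) {t : ℝ} (ht : 0 < t) :
    Integrable (gaussKernel n t) := by
  have h := GaussianFourier.integrable_cexp_neg_mul_sq_norm_add (V := RSp n)
    (b := ((1 / (4 * t) : ℝ) : ℂ)) (by simpa using ht) 0 0
  have h2 := h.norm.const_mul ((4 * Real.pi * t) ^ (-((n : ℝ) / 2)))
  refine h2.congr (Filter.Eventually.of_forall fun x => ?_)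
  simp only [gaussKernel, Complex.norm_exp]
  congr 2
  have : (-(((1 / (4 * t) : ℝ) : ℂ)) * (‖x‖ : ℂ) ^ 2 + 0 * ((inner ℝ (0 : RSp n) x : ℝ) : ℂ))
      = ((-(‖x‖ ^ 2 / (4 * t)) : ℝ) : ℂ) := by
    push_cast
    ring
  rw [this, Complex.ofReal_re]

/-- The convolution `G_t ∗ φ`. -/
noncomputable def heatConv (n : ℕ) (t : ℝ) (φ : RSp n → ℝ) (x : RSp n) : ℝ :=
  ∫ y, gaussKernel n t (x - y) * φ y

theorem integrable_heatConv (n : ℕ) {t : ℝ} (ht : 0 < t) (φ : L1Sp n) :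
    Integrable (heatConv n t φ) := by
  have h := (L1.integrable_coeFn φ).integrable_convolution
    (ContinuousLinearMap.mul ℝ ℝ) (integrable_gaussKernel n ht)
  refine h.congr (Filter.Eventually.of_forall fun x => ?_)
  simp only [convolution, heatConv, ContinuousLinearMap.mul_apply']
  exact integral_congr_ae (Filter.Eventually.of_forall fun y => mul_comm _ _)

/-- The heat semigroup on `L¹(ℝⁿ)`: `e^{tΔ}φ = G_t ∗ φ` for `t > 0` and `e^{0Δ}φ = φ`
(the value at negative times is irrelevant). -/
noncomputable def heat (n : ℕ) (t : ℝ) (φ : L1Sp n) : L1Sp n :=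
  if ht : 0 < t then (integrable_heatConv n ht φ).toL1 (heatConv n t φ) else φ

open Classical in
/-- The superposition `v ↦ f(v) = f ∘ v`, as an element of `L¹(ℝⁿ)`. It is used for
`v ∈ L¹ ∩ L^∞`, where `f ∘ v` is integrable for the nonlinearities `f` considered here;
the value `0` is a placeholder where `f ∘ v` is not integrable. -/
noncomputable def superpos (n : ℕ) (f : ℝ → ℝ) (v : L1Sp n) : L1Sp n :=
  if h : Integrable (fun x => f (v x)) then h.toL1 (fun x => f (v x)) else 0

/-- The space
`X = (C ∩ L^∞)([0,∞); L¹(ℝⁿ)) ∩ (C ∩ L^∞)((0,∞); L^∞(ℝⁿ))`.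
Values of `u` at negative times are irrelevant. -/
def MemX (n : ℕ) (u : ℝ → L1Sp n) : Prop :=
  (ContinuousOn u (Ici 0) ∧ ∃ M : ℝ, ∀ t, 0 ≤ t → ‖u t‖ ≤ M) ∧
  ∃ w : ℝ → LinfSp n, (∀ t, 0 < t → (w t : RSp n → ℝ) =ᵐ[volume] u t) ∧
    ContinuousOn w (Ioi 0) ∧ ∃ M : ℝ, ∀ t, 0 < t → ‖w t‖ ≤ M

/-- `u` is a global (mild) solution of `∂ₜu - Δu = f(u)`, `u(0) = φ`: for every `t ≥ 0`,
`u(t) = e^{tΔ}φ + ∫₀ᵗ e^{(t-s)Δ} f(u(s)) ds`,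
where the integral converges as a Bochner integral in `L¹(ℝⁿ)`. -/
def IsMildSolution (n : ℕ) (f : ℝ → ℝ) (φ : L1Sp n) (u : ℝ → L1Sp n) : Prop :=
  ∀ t, 0 ≤ t →
    IntervalIntegrable (fun s => heat n (t - s) (superpos n f (u s))) volume 0 t ∧
    u t = heat n t φ + ∫ s in (0 : ℝ)..t, heat n (t - s) (superpos n f (u s))

/-- The uniform decay
`sup_{q ∈ [1,∞]} sup_{t ≥ 0} (1+t)^{(n/2)(1-1/q)} ‖u(t)‖_q < ∞`. -/
def UniformDecay (n : ℕ) (u : ℝ → L1Sp n) : Prop :=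
  ∃ M : ℝ, ∀ q : ENNReal, 1 ≤ q → ∀ t : ℝ, 0 ≤ t →
    ENNReal.ofReal ((1 + t) ^ ((n : ℝ) / 2 * (1 - q⁻¹.toReal))) * eLpNorm (u t) q volume
      ≤ ENNReal.ofReal M

/-- The modified datum `φ₁ = φ + ∫₀^∞ f(u(s)) ds`. -/
noncomputable def firstDatum (n : ℕ) (f : ℝ → ℝ) (φ : L1Sp n) (u : ℝ → L1Sp n) : L1Sp n :=
  φ + ∫ s in Ioi (0 : ℝ), superpos n f (u s)

/-- The modified datum `φ + ∫₀^∞ (f(u(s)) - f(v(s))) ds`; it is `φ_N` for `v = u_{N-1}`. -/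
noncomputable def nextDatum (n : ℕ) (f : ℝ → ℝ) (φ : L1Sp n) (u v : ℝ → L1Sp n) : L1Sp n :=
  φ + ∫ s in Ioi (0 : ℝ), (superpos n f (u s) - superpos n f (v s))

/-- The approximations `u_N`, `N ≥ 1`: `u₁(t) = e^{tΔ}φ₁` and, for `N ≥ 2`,
`u_N(t) = e^{tΔ}φ_N + ∫₀ᵗ e^{(t-s)Δ} f(u_{N-1}(s)) ds`. (Also `u₀ = 0`.) -/
noncomputable def approx (n : ℕ) (f : ℝ → ℝ) (φ : L1Sp n) (u : ℝ → L1Sp n) :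
    ℕ → ℝ → L1Sp n
  | 0 => fun _ => 0
  | 1 => fun t => heat n t (firstDatum n f φ u)
  | N + 2 => fun t =>
      heat n t (nextDatum n f φ u (approx n f φ u (N + 1))) +
        ∫ s in (0 : ℝ)..t, heat n (t - s) (superpos n f (approx n f φ u (N + 1) s))

/-- All the objects entering the recursion for `u_N` are genuine: every `u_N(t)`, `t > 0`, is
also in `L^∞`, and all the integrals in the definitions of `φ_N` and `u_N` converge as Bochner
integrals in `L¹(ℝⁿ)`. -/
def ApproxWellDefined (n : ℕ) (f : ℝ → ℝ) (φ : L1Sp n) (u : ℝ → L1Sp n) : Prop :=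
  IntegrableOn (fun s => superpos n f (u s)) (Ioi 0) ∧
  ∀ N : ℕ, 1 ≤ N →
    (∀ t : ℝ, 0 < t → MemLp (approx n f φ u N t) ⊤ volume) ∧
    IntegrableOn (fun s => superpos n f (u s) - superpos n f (approx n f φ u N s)) (Ioi 0) ∧
    ∀ t : ℝ, 0 < t →
      IntervalIntegrable (fun s => heat n (t - s) (superpos n f (approx n f φ u N s))) volume 0 t

/-- The rate `t^{-a}` if `a < 1`, `t^{-1} log(1+t)` if `a = 1`, and `t^{-1}` if `a > 1`. -/
noncomputable def decayRate (a t : ℝ) : ℝ :=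
  if a < 1 then t ^ (-a)
  else if a = 1 then t⁻¹ * Real.log (1 + t)
  else t⁻¹

/-! Everything is measured by one pair of bounds, `‖v‖₁ ≤ B` and `‖v‖_∞ ≤ B R`, bundled as
`Controlled B R v`. The intermediate exponents `q` are recovered only at the end, by the
interpolation `Controlled.eLpNorm_le`. With `R = (1+t)^{-n/2}` the pair is the decay of the heat
flow of a datum in `L¹ ∩ L^∞`. If `u(s)` obeys it with `B = M`, the growth condition on `f`
multiplies both bounds by `K (M (1+s)^{-n/2})^{p-1} = K M^{p-1} (1+s)^{-1-σ}`. The hypothesis `p > 1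
+ 2/n` says exactly that `σ > 0`, so `f(u(s))` is a source of finite total mass. Its Duhamel
integral decays like a heat flow (`DecayingSource.controlled_duhamel`), and a small `M` closes a
contraction argument (`PowerLipschitz.exists_decayingOrbit`).

For the asymptotics, let a source `F` decay like `(1+s)^{-1-a}`. The difference between its Duhamel
integral and `e^{tΔ} ∫₀^∞ F` is controlled by the mass of `F` weighted by `min(1, s/t)`. For `s ≤
t/2` this is the kernel estimate `|G_{t-s} - G_t| ≲ (s/t) G_{2t}` (`abs_gaussKernel_sub_le`); for
larger `s` no cancellation is needed. The weighted mass has order `t^{-a}`, `t^{-1} log(1+t)` or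
`t^{-1}` (`sourceMass_le`, `DecayingSource.controlled_duhamel_sub_heat`).

The data `φ_N` are chosen so that `u - u_{N+1}` is exactly such a difference, for the source `f(u) -
f(u_N)`. If `u - u_N` gains a factor `(1+s)^{-b}`, this source has exponent `a = σ + b`: each step
gains `σ`, until the rate saturates at `t^{-1}`. The iteration starts from `u₀ = 0` with `b = 0`. To
keep logarithms out of the induction, `PowerLipschitz.approxError` records only powers `b < 1`, `b ≤
Nσ`; the sharp rate is read off from one more step (`ApproxError.exists_controlled`). -/

/-! ### The Gauss kernel and its regularity in time. -/

open Real in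
theorem gaussKernel_nonneg (n : ℕ) {t : ℝ} (ht : 0 ≤ t) (x : RSp n) : 0 ≤ gaussKernel n t x := by
  unfold gaussKernel; positivity

open Real in
theorem gaussKernel_le (n : ℕ) {t : ℝ} (ht : 0 < t) (x : RSp n) :
    gaussKernel n t x ≤ (4 * π * t) ^ (-((n : ℝ) / 2)) := by
  unfold gaussKernel
  refine mul_le_of_le_one_right (by positivity) (Real.exp_le_one_iff.2 ?_)
  have : 0 ≤ ‖x‖ ^ 2 / (4 * t) := by positivity
  linarith

theorem continuous_gaussKernel (n : ℕ) (t : ℝ) : Continuous (gaussKernel n t) := by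
  unfold gaussKernel; fun_prop

open Real in
theorem integral_gaussKernel (n : ℕ) {t : ℝ} (ht : 0 < t) : ∫ x, gaussKernel n t x = 1 := by
  have h := GaussianFourier.integral_rexp_neg_mul_sq_norm (V := RSp n)
    (b := 1 / (4 * t)) (by positivity)
  have h2 : ∀ x : RSp n, gaussKernel n t x =
      (4 * π * t) ^ (-((n : ℝ) / 2)) * rexp (-(1 / (4 * t)) * ‖x‖ ^ 2) := fun x => by
    unfold gaussKernel; congr 2; ring
  simp only [h2, integral_const_mul, h, finrank_euclideanSpace_fin]
  rw [show π / (1 / (4 * t)) = 4 * π * t by field_simp, ← Real.rpow_add (by positivity)]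
  simp

/-- The constant in the Lipschitz estimate of the Gauss kernel in time. -/
noncomputable def gaussLip (n : ℕ) : ℝ := (4 + n) * 4 ^ ((n : ℝ) / 2)

theorem gaussLip_ge (n : ℕ) : 4 ≤ gaussLip n := by
  have h1 : (1 : ℝ) ≤ 4 ^ ((n : ℝ) / 2) := Real.one_le_rpow (by norm_num) (by positivity)
  have h2 : (0 : ℝ) ≤ n := by positivity
  unfold gaussLip
  nlinarith

open Real in
theorem hasDerivAt_gaussKernel (n : ℕ) {t : ℝ} (ht : 0 < t) (x : RSp n) :
    HasDerivAt (fun τ => gaussKernel n τ x)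
      ((‖x‖ ^ 2 / (4 * t) - n / 2) / t * gaussKernel n t x) t := by
  have h1 : HasDerivAt (fun τ : ℝ => 4 * π * τ) (4 * π) t := by
    simpa using (hasDerivAt_id t).const_mul (4 * π)
  have h2 := h1.rpow_const (p := -((n : ℝ) / 2)) (Or.inl (by positivity))
  have h3 : HasDerivAt (fun τ : ℝ => rexp (-(‖x‖ ^ 2 / (4 * τ))))
      (rexp (-(‖x‖ ^ 2 / (4 * t))) * (‖x‖ ^ 2 / (4 * t ^ 2))) t := by
    refine HasDerivAt.exp ?_
    have h4 := ((hasDerivAt_inv ht.ne').const_mul (‖x‖ ^ 2 / 4)).neg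
    refine (h4.congr_deriv (by field_simp)).congr_of_eventuallyEq
      (Filter.Eventually.of_forall fun τ => ?_)
    simp only [Pi.neg_apply]
    rw [div_mul_eq_div_div, div_eq_mul_inv]
  refine (h2.mul h3).congr_deriv ?_
  unfold gaussKernel
  rw [Real.rpow_sub_one (by positivity)]
  field_simp
  ring

-- The time derivative of the kernel is the kernel times `(y - n/2)/τ` with `y = |x|²/(4τ)`. Half of
-- the Gaussian exponent absorbs the factor `y`, and the other half leaves a multiple of `G_{2t}`;
-- the mean value inequality on `[t/2, t]` concludes. A pointwise bound by a kernel serves the `L¹`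
-- and the `L^∞` estimates at once.
open Real in
theorem abs_gaussKernel_sub_le (n : ℕ) {s t : ℝ} (hs : 0 ≤ s) (hst : s ≤ t / 2) (ht : 0 < t)
    (x : RSp n) :
    |gaussKernel n (t - s) x - gaussKernel n t x|
      ≤ gaussLip n * (s / t) * gaussKernel n (2 * t) x := by
  have key : ∀ τ ∈ Icc (t / 2) t, ‖(‖x‖ ^ 2 / (4 * τ) - n / 2) / τ * gaussKernel n τ x‖
      ≤ gaussLip n / t * gaussKernel n (2 * t) x := by
    intro τ hτ
    have hτ0 : 0 < τ := by linarith [hτ.1]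
    set y := ‖x‖ ^ 2 / (4 * τ) with hy
    have hy0 : 0 ≤ y := by positivity
    rw [norm_mul, norm_div, Real.norm_eq_abs, Real.norm_eq_abs, Real.norm_eq_abs,
      abs_of_pos hτ0, abs_of_nonneg (gaussKernel_nonneg n hτ0.le x)]
    have e1 : |y - n / 2| ≤ y + n / 2 :=
      abs_le.2 ⟨by linarith, by linarith [show (0 : ℝ) ≤ n / 2 by positivity]⟩
    have e2 : (y + n / 2) * rexp (-y) ≤ (2 + n / 2) * rexp (-(y / 2)) := by
      have := Real.add_one_le_exp (y / 2)
      have e3 : rexp (-y) = rexp (-(y / 2)) * rexp (-(y / 2)) := by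
        rw [← Real.exp_add]; congr 1; ring
      have e4 : rexp (y / 2) * rexp (-(y / 2)) = 1 := by rw [← Real.exp_add]; simp
      have e5 : rexp (-(y / 2)) ≤ 1 := Real.exp_le_one_iff.2 (by linarith)
      have e6 : (y + n / 2) * rexp (-(y / 2)) ≤ 2 + n / 2 := by
        have a1 : y * rexp (-(y / 2)) ≤ 2 * (rexp (y / 2) * rexp (-(y / 2))) := by
          rw [← mul_assoc]
          gcongr
          linarith
        have a2 : (n : ℝ) / 2 * rexp (-(y / 2)) ≤ n / 2 :=
          mul_le_of_le_one_right (by positivity) e5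
        rw [e4] at a1
        linarith
      rw [e3, ← mul_assoc]
      gcongr
    have e7 : rexp (-(y / 2)) ≤ rexp (-(‖x‖ ^ 2 / (4 * (2 * t)))) := by
      rw [Real.exp_le_exp, hy, div_div, neg_le_neg_iff]
      exact div_le_div_of_nonneg_left (by positivity) (by positivity) (by linarith [hτ.2])
    -- Since `τ ≥ t/2 = 2t/4`, passing to the prefactor of `G_{2t}` costs `4^{n/2}`.
    have e8 : (4 * π * τ) ^ (-((n : ℝ) / 2)) ≤
        4 ^ ((n : ℝ) / 2) * (4 * π * (2 * t)) ^ (-((n : ℝ) / 2)) := by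
      have : (4 * π * τ) ^ (-((n : ℝ) / 2)) ≤ (4 * π * (2 * t) / 4) ^ (-((n : ℝ) / 2)) := by
        apply Real.rpow_le_rpow_of_nonpos (by positivity)
        · nlinarith [hτ.1, Real.pi_pos]
        · have : (0 : ℝ) ≤ n / 2 := by positivity
          linarith
      refine this.trans_eq ?_
      rw [Real.div_rpow (by positivity) (by positivity), Real.rpow_neg (x := 4) (by norm_num),
        div_inv_eq_mul, mul_comm]
    calc |y - n / 2| / τ * gaussKernel n τ x
        ≤ (y + n / 2) / (t / 2) * ((4 * π * τ) ^ (-((n : ℝ) / 2)) * rexp (-y)) := by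
          unfold gaussKernel
          gcongr
          exact hτ.1
      _ = 2 / t * (4 * π * τ) ^ (-((n : ℝ) / 2)) * ((y + n / 2) * rexp (-y)) := by
          field_simp
      _ ≤ 2 / t * (4 ^ ((n : ℝ) / 2) * (4 * π * (2 * t)) ^ (-((n : ℝ) / 2))) *
          ((2 + n / 2) * rexp (-(‖x‖ ^ 2 / (4 * (2 * t))))) := by
          gcongr ?_ * ?_ * ?_
          exact e2.trans (by gcongr)
      _ = _ := by
          unfold gaussLip gaussKernel
          field_simp
          ring
  have h := (convex_Icc (t / 2) t).norm_image_sub_le_of_norm_hasDerivWithin_le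
    (f := fun τ => gaussKernel n τ x)
    (fun τ hτ => (hasDerivAt_gaussKernel n (by linarith [hτ.1]) x).hasDerivWithinAt) key
    (x := t) (y := t - s) ⟨by linarith, le_rfl⟩ ⟨by linarith, by linarith⟩
  rw [Real.norm_eq_abs, Real.norm_eq_abs, show t - s - t = -s by ring, abs_neg,
    abs_of_nonneg hs] at h
  refine h.trans_eq ?_
  ring

/-- The `L¹` modulus of continuity of the Gauss kernel in time. -/
theorem integral_abs_gaussKernel_sub_le (n : ℕ) {τ h : ℝ} (hτ : 0 < τ) (hh : 0 ≤ h) :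
    ∫ x, |gaussKernel n (τ + h) x - gaussKernel n τ x| ≤ gaussLip n * √(h / τ) := by
  have hC := gaussLip_ge n
  have i1 := integrable_gaussKernel n hτ
  have i2 := integrable_gaussKernel n (show 0 < τ + h by linarith)
  -- For `h ≤ τ` the linear bound `h/τ ≤ 1` is weakened to its square root; for `h ≥ τ` the two unit
  -- masses suffice. The square root is what makes the singularity at `s = t` integrable when `τ = t
  -- - s`.
  rcases le_total h τ with hle | hle
  · have i3 := integrable_gaussKernel n (show 0 < 2 * (τ + h) by linarith)
    have hb : ∀ x, |gaussKernel n (τ + h) x - gaussKernel n τ x| ≤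
        gaussLip n * (h / (τ + h)) * gaussKernel n (2 * (τ + h)) x := fun x => by
      have := abs_gaussKernel_sub_le n hh (t := τ + h) (by linarith) (by linarith) x
      rwa [add_sub_cancel_right, abs_sub_comm] at this
    have h1 := integral_mono (i2.sub i1).abs (i3.const_mul _) hb
    rw [integral_const_mul, integral_gaussKernel n (by linarith), mul_one] at h1
    refine h1.trans ?_
    gcongr
    have h2 : h / (τ + h) ≤ h / τ := by gcongr; linarith
    have h3 : h / τ ≤ 1 := (div_le_one hτ).2 hle
    have h4 : 0 ≤ h / τ := by positivity
    exact h2.trans (Real.le_sqrt_of_sq_le (by nlinarith))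
  · have hb : ∀ x, |gaussKernel n (τ + h) x - gaussKernel n τ x| ≤
        gaussKernel n (τ + h) x + gaussKernel n τ x := fun x =>
      (abs_sub _ _).trans_eq (by
        rw [abs_of_nonneg (gaussKernel_nonneg n (by linarith) x),
          abs_of_nonneg (gaussKernel_nonneg n (by linarith) x)])
    have h1 := integral_mono (i2.sub i1).abs (i2.add i1) hb
    simp only [Pi.add_apply] at h1
    rw [integral_add i2 i1, integral_gaussKernel n hτ,
      integral_gaussKernel n (by linarith)] at h1
    have h3 : 1 ≤ h / τ := (one_le_div hτ).2 hle
    have h4 : 1 ≤ √(h / τ) := Real.one_le_sqrt.2 h3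
    refine h1.trans ?_
    nlinarith

/-! ### Young-type bounds for convolution with an integrable or bounded kernel. -/

section Convolution
variable {n : ℕ} {k v : RSp n → ℝ}

theorem integrable_kernel_conv (hk : Integrable k) (hv : Integrable v) :
    Integrable fun x => ∫ y, k (x - y) * v y := by
  have h := hv.integrable_convolution (ContinuousLinearMap.mul ℝ ℝ) hk
  refine h.congr (Filter.Eventually.of_forall fun x => ?_)
  simp only [convolution, ContinuousLinearMap.mul_apply']
  exact integral_congr_ae (Filter.Eventually.of_forall fun y => mul_comm _ _)

theorem integral_abs_kernel_conv_le (hk : Integrable k) (hv : Integrable v) :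
    ∫ x, |∫ y, k (x - y) * v y| ≤ (∫ x, |k x|) * ∫ x, |v x| := by
  have h1 := integral_convolution (ContinuousLinearMap.mul ℝ ℝ) hv.abs hk.abs
  have h2 := integrable_kernel_conv hk.abs hv.abs
  rw [ContinuousLinearMap.mul_apply', mul_comm] at h1
  rw [← h1]
  simp only [convolution, ContinuousLinearMap.mul_apply']
  have h3 : ∀ x, |∫ y, k (x - y) * v y| ≤ ∫ y, |v y| * |k (x - y)| := fun x => by
    refine (abs_integral_le_integral_abs).trans_eq ?_
    simp only [abs_mul, mul_comm]
  refine integral_mono (integrable_kernel_conv hk hv).abs ?_ h3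
  simpa only [mul_comm] using h2

theorem abs_kernel_conv_le_of_ae_bound (hk : Integrable k) {M : ℝ} (hM : ∀ᵐ x, |v x| ≤ M)
    (x : RSp n) : |∫ y, k (x - y) * v y| ≤ (∫ x, |k x|) * M := by
  have h := norm_integral_le_of_norm_le (f := fun y => k (x - y) * v y)
    (g := fun y => |k (x - y)| * M) (μ := volume) ((hk.comp_sub_left x).abs.mul_const M)
    (by
      filter_upwards [hM] with y hy
      rw [Real.norm_eq_abs, abs_mul]
      gcongr)
  rw [integral_mul_const, integral_sub_left_eq_self (fun y => |k y|)] at h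
  exact h

theorem abs_kernel_conv_le_of_bound (hv : Integrable v) {B : ℝ} (hB : ∀ x, |k x| ≤ B)
    (x : RSp n) : |∫ y, k (x - y) * v y| ≤ B * ∫ x, |v x| := by
  have h := norm_integral_le_of_norm_le (f := fun y => k (x - y) * v y)
    (g := fun y => B * |v y|) (μ := volume) (hv.abs.const_mul B)
    (Filter.Eventually.of_forall fun y => by
      rw [Real.norm_eq_abs, abs_mul]
      gcongr
      exact hB _)
  rwa [integral_const_mul] at h

theorem integrable_gaussKernel_mul (hv : Integrable v) {t : ℝ} (ht : 0 < t) (x : RSp n) :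
    Integrable fun y => gaussKernel n t (x - y) * v y :=
  hv.bdd_mul (c := (4 * Real.pi * t) ^ (-((n : ℝ) / 2)))
    ((continuous_gaussKernel n t).comp (continuous_const.sub continuous_id)).aestronglyMeasurable
    (Filter.Eventually.of_forall fun y => by
      rw [Real.norm_eq_abs, abs_of_nonneg (gaussKernel_nonneg n ht.le _)]
      exact gaussKernel_le n ht _)

end Convolution

/-! ### The heat semigroup on `L¹` and its continuity at positive times. -/

section Heat
variable {n : ℕ}

theorem integrable_coe_L1 (v : L1Sp n) : Integrable v := L1.integrable_coeFn v

theorem norm_L1_eq (v : L1Sp n) : ‖v‖ = ∫ x, |v x| := L1.norm_eq_integral_norm v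

theorem heat_of_nonpos {t : ℝ} (ht : t ≤ 0) (v : L1Sp n) : heat n t v = v :=
  dif_neg ht.not_gt

theorem coeFn_heat {t : ℝ} (ht : 0 < t) (v : L1Sp n) :
    heat n t v =ᵐ[volume] fun x => ∫ y, gaussKernel n t (x - y) * v y := by
  rw [heat, dif_pos ht]
  exact Integrable.coeFn_toL1 _

theorem heat_add (t : ℝ) (v w : L1Sp n) : heat n t (v + w) = heat n t v + heat n t w := by
  rcases le_or_gt t 0 with ht | ht
  · simp only [heat_of_nonpos ht]
  refine Lp.ext ?_
  filter_upwards [coeFn_heat ht (v + w), coeFn_heat ht v, coeFn_heat ht w,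
    Lp.coeFn_add (heat n t v) (heat n t w)] with x h1 h2 h3 h4
  rw [h1, h4, Pi.add_apply, h2, h3, ← integral_add
    (integrable_gaussKernel_mul (integrable_coe_L1 v) ht x)
    (integrable_gaussKernel_mul (integrable_coe_L1 w) ht x)]
  refine integral_congr_ae ?_
  filter_upwards [Lp.coeFn_add v w] with y hy
  rw [hy, Pi.add_apply, mul_add]

theorem heat_smul (t c : ℝ) (v : L1Sp n) : heat n t (c • v) = c • heat n t v := by
  rcases le_or_gt t 0 with ht | ht
  · simp only [heat_of_nonpos ht]
  refine Lp.ext ?_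
  filter_upwards [coeFn_heat ht (c • v), coeFn_heat ht v,
    Lp.coeFn_smul c (heat n t v)] with x h1 h2 h4
  rw [h1, h4, Pi.smul_apply, h2, smul_eq_mul, ← integral_const_mul]
  refine integral_congr_ae ?_
  filter_upwards [Lp.coeFn_smul c v] with y hy
  rw [hy, Pi.smul_apply, smul_eq_mul]
  ring

theorem integral_abs_gaussKernel {t : ℝ} (ht : 0 < t) : ∫ x, |gaussKernel n t x| = 1 := by
  rw [← integral_gaussKernel n ht]
  exact integral_congr_ae (Filter.Eventually.of_forall fun x =>
    abs_of_nonneg (gaussKernel_nonneg n ht.le x))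

theorem norm_heat_le (t : ℝ) (v : L1Sp n) : ‖heat n t v‖ ≤ ‖v‖ := by
  rcases le_or_gt t 0 with ht | ht
  · simp only [heat_of_nonpos ht, le_refl]
  have h := integral_abs_kernel_conv_le (integrable_gaussKernel n ht) (integrable_coe_L1 v)
  rw [integral_abs_gaussKernel ht, one_mul] at h
  rw [norm_L1_eq, norm_L1_eq]
  refine (integral_congr_ae ?_).trans_le h
  filter_upwards [coeFn_heat ht v] with x hx
  rw [hx]

/-- The heat semigroup as a bounded operator on `L¹`. -/
noncomputable def heatCLM (n : ℕ) (t : ℝ) : L1Sp n →L[ℝ] L1Sp n :=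
  LinearMap.mkContinuous
    { toFun := heat n t, map_add' := heat_add t, map_smul' := heat_smul t } 1
    fun v => by simpa using norm_heat_le t v

theorem heatCLM_apply (t : ℝ) (v : L1Sp n) : heatCLM n t v = heat n t v := rfl

theorem heat_sub (t : ℝ) (v w : L1Sp n) : heat n t (v - w) = heat n t v - heat n t w :=
  map_sub (heatCLM n t) v w

theorem heat_zero (t : ℝ) : heat n t (0 : L1Sp n) = 0 := map_zero (heatCLM n t)

theorem coeFn_heat_sub {t t' : ℝ} (ht : 0 < t) (ht' : 0 < t') (v : L1Sp n) :
    (heat n t v - heat n t' v : L1Sp n) =ᵐ[volume]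
      fun x => ∫ y, (gaussKernel n t (x - y) - gaussKernel n t' (x - y)) * v y := by
  filter_upwards [coeFn_heat ht v, coeFn_heat ht' v, Lp.coeFn_sub (heat n t v) (heat n t' v)]
    with x h1 h2 h3
  rw [h3, Pi.sub_apply, h1, h2, ← integral_sub
    (integrable_gaussKernel_mul (integrable_coe_L1 v) ht x)
    (integrable_gaussKernel_mul (integrable_coe_L1 v) ht' x)]
  simp only [sub_mul]

theorem norm_heat_sub_le_integral {t t' : ℝ} (ht : 0 < t) (ht' : 0 < t') (v : L1Sp n) :
    ‖heat n t v - heat n t' v‖ ≤ (∫ x, |gaussKernel n t x - gaussKernel n t' x|) * ‖v‖ := by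
  have h := integral_abs_kernel_conv_le
    ((integrable_gaussKernel n ht).sub (integrable_gaussKernel n ht')) (integrable_coe_L1 v)
  rw [norm_L1_eq, norm_L1_eq]
  refine (integral_congr_ae ?_).trans_le h
  filter_upwards [coeFn_heat_sub ht ht' v] with x hx
  rw [hx]
  rfl

theorem norm_heat_add_sub_le {τ h : ℝ} (hτ : 0 < τ) (hh : 0 ≤ h) (v : L1Sp n) :
    ‖heat n (τ + h) v - heat n τ v‖ ≤ gaussLip n * √(h / τ) * ‖v‖ :=
  (norm_heat_sub_le_integral (by linarith) hτ v).trans (by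
    gcongr
    exact integral_abs_gaussKernel_sub_le n hτ hh)

theorem norm_heat_sub_le {t t' : ℝ} (ht : 0 < t) (ht' : 0 < t') (v : L1Sp n) :
    ‖heat n t v - heat n t' v‖ ≤ gaussLip n * √(|t - t'| / min t t') * ‖v‖ := by
  rcases le_total t t' with h | h
  · have := norm_heat_add_sub_le ht (sub_nonneg.2 h) v
    rwa [min_eq_left h, norm_sub_rev, abs_sub_comm, abs_of_nonneg (sub_nonneg.2 h),
      show t' = t + (t' - t) by ring, show t + (t' - t) - t = t' - t by ring]
  · have := norm_heat_add_sub_le ht' (sub_nonneg.2 h) v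
    rwa [min_eq_right h, abs_of_nonneg (sub_nonneg.2 h),
      show t = t' + (t - t') by ring, show t' + (t - t') - t' = t - t' by ring]

open Filter Topology in
theorem tendsto_heat_of_pos {t₀ : ℝ} (ht₀ : 0 < t₀) (v : L1Sp n) :
    Tendsto (fun t => heat n t v) (𝓝 t₀) (𝓝 (heat n t₀ v)) := by
  rw [tendsto_iff_norm_sub_tendsto_zero]
  have hc : ContinuousAt (fun t => gaussLip n * √(|t - t₀| / min t t₀) * ‖v‖) t₀ := by
    refine ((ContinuousAt.sqrt (ContinuousAt.div ?_ ?_ ?_)).const_mul _).mul_const _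
    · fun_prop
    · fun_prop
    · simpa using ht₀.ne'
  have hc' : Tendsto (fun t => gaussLip n * √(|t - t₀| / min t t₀) * ‖v‖) (𝓝 t₀) (𝓝 0) := by
    simpa [ContinuousAt] using hc
  refine squeeze_zero' (Eventually.of_forall fun t => norm_nonneg _) ?_ hc'
  filter_upwards [lt_mem_nhds ht₀] with t ht
  exact norm_heat_sub_le ht ht₀ v

-- Contractivity, uniform in time, upgrades continuity in time for a fixed vector to joint
-- continuity.
open Filter Topology in
theorem tendsto_heat_uncurry {ι : Type*} {l : Filter ι} {τ : ι → ℝ} {w : ι → L1Sp n} {t₀ : ℝ}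
    {v : L1Sp n} (hH : Tendsto (fun i => heat n (τ i) v) l (𝓝 (heat n t₀ v)))
    (hw : Tendsto w l (𝓝 v)) :
    Tendsto (fun i => heat n (τ i) (w i)) l (𝓝 (heat n t₀ v)) := by
  have h1 : Tendsto (fun i => heat n (τ i) (w i - v)) l (𝓝 0) := by
    refine squeeze_zero_norm (fun i => norm_heat_le _ _) ?_
    exact tendsto_iff_norm_sub_tendsto_zero.1 hw
  refine (h1.add hH).congr' (Eventually.of_forall fun i => ?_) |>.trans (by rw [zero_add])
  rw [heat_sub, sub_add_cancel]

end Heat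

/-! ### Simultaneous `L¹` and `L^∞` bounds. -/

section Controlled
variable {n : ℕ}

/-- Integration over a set, as a bounded functional on `L¹`. -/
noncomputable def setIntegralCLM (A : Set (RSp n)) : L1Sp n →L[ℝ] ℝ where
  toFun v := ∫ x in A, v x
  map_add' v w := by
    rw [← integral_add (integrable_coe_L1 v).integrableOn (integrable_coe_L1 w).integrableOn]
    exact integral_congr_ae (ae_restrict_of_ae (Lp.coeFn_add v w))
  map_smul' c v := by
    rw [RingHom.id_apply, smul_eq_mul, ← integral_const_mul]
    exact integral_congr_ae (ae_restrict_of_ae (Lp.coeFn_smul c v))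
  cont := continuous_setIntegral A

/-- A Bochner integral in `L¹` has no pointwise formula to estimate. The bound is instead tested on
sets `A` of finite measure, where integration over `A` is a bounded functional and commutes with the
integral in `s`. -/
theorem ae_integral_le_integral {α : Type*} [MeasurableSpace α] {μ : Measure α}
    {F : α → L1Sp n} {b : α → ℝ} (hF : Integrable F μ) (hb : Integrable b μ)
    (h : ∀ᵐ s ∂μ, ∀ᵐ x, F s x ≤ b s) : ∀ᵐ x, (∫ s, F s ∂μ) x ≤ ∫ s, b s ∂μ := by
  set v : L1Sp n := ∫ s, F s ∂μ with hv
  have hint : ∀ A : Set (RSp n), volume A < ⊤ → ∀ c : ℝ, IntegrableOn (fun _ => c) A volume :=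
    fun A hA c => integrableOn_const hA.ne
  have key : 0 ≤ᵐ[volume] fun x => (∫ s, b s ∂μ) - v x := by
    refine ae_nonneg_of_forall_setIntegral_nonneg_of_sigmaFinite (fun A _ hA =>
      (hint A hA _).sub (integrable_coe_L1 v).integrableOn) fun A _ hA => ?_
    rw [integral_sub (hint A hA _) (integrable_coe_L1 v).integrableOn, sub_nonneg,
      setIntegral_const, smul_eq_mul, ← integral_const_mul]
    have h1 := (setIntegralCLM A).integral_comp_comm hF
    change _ = ∫ x in A, v x at h1
    rw [← h1]
    refine integral_mono_ae ((setIntegralCLM A).integrable_comp hF) (hb.const_mul _) ?_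
    filter_upwards [h] with s hs
    have h2 : ∫ x in A, F s x ≤ ∫ _ in A, b s :=
      integral_mono_ae (integrable_coe_L1 _).integrableOn (hint A hA _) (ae_restrict_of_ae hs)
    rwa [setIntegral_const, smul_eq_mul] at h2
  filter_upwards [key] with x hx
  exact sub_nonneg.1 hx

/-- `v` has `L¹` norm at most `B` and `L^∞` norm at most `B * R`. -/
structure Controlled (B R : ℝ) (v : L1Sp n) : Prop where
  norm_le : ‖v‖ ≤ B
  ae_le : ∀ᵐ x, |v x| ≤ B * R

namespace Controlled
variable {B B' R R' : ℝ} {v w : L1Sp n}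

theorem nonneg (h : Controlled B R v) : 0 ≤ B := (norm_nonneg v).trans h.norm_le

theorem mono_left (h : Controlled B R v) (hB : B ≤ B') (hR : 0 ≤ R) : Controlled B' R v :=
  ⟨h.norm_le.trans hB, h.ae_le.mono fun _ hx => hx.trans (by gcongr)⟩

theorem mono_right (h : Controlled B R v) (hR : R ≤ R') : Controlled B R' v :=
  ⟨h.norm_le, h.ae_le.mono fun _ hx => hx.trans (by have := h.nonneg; gcongr)⟩

theorem mono (h : Controlled B R v) (hB : B ≤ B') (hR : R ≤ R') (hR0 : 0 ≤ R) :
    Controlled B' R' v :=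
  (h.mono_left hB hR0).mono_right hR

theorem zero (R : ℝ) : Controlled 0 R (0 : L1Sp n) :=
  ⟨by simp, by filter_upwards [Lp.coeFn_zero ℝ 1 (volume : Measure (RSp n))] with x; simp⟩

theorem add (h : Controlled B R v) (h' : Controlled B' R w) :
    Controlled (B + B') R (v + w) := by
  refine ⟨(norm_add_le _ _).trans (add_le_add h.norm_le h'.norm_le), ?_⟩
  filter_upwards [h.ae_le, h'.ae_le, Lp.coeFn_add v w] with x h1 h2 h3
  rw [h3, Pi.add_apply, add_mul]
  exact (abs_add_le _ _).trans (add_le_add h1 h2)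

theorem neg (h : Controlled B R v) : Controlled B R (-v) := by
  refine ⟨by rw [norm_neg]; exact h.norm_le, ?_⟩
  filter_upwards [h.ae_le, Lp.coeFn_neg v] with x h1 h3
  rwa [h3, Pi.neg_apply, abs_neg]

theorem sub (h : Controlled B R v) (h' : Controlled B' R w) :
    Controlled (B + B') R (v - w) := by
  rw [sub_eq_add_neg]
  exact h.add h'.neg

theorem integral {α : Type*} [MeasurableSpace α] {μ : Measure α} {F : α → L1Sp n} {b : α → ℝ}
    (hF : Integrable F μ) (hb : Integrable b μ) (h : ∀ᵐ s ∂μ, Controlled (b s) R (F s)) :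
    Controlled (∫ s, b s ∂μ) R (∫ s, F s ∂μ) := by
  refine ⟨norm_integral_le_of_norm_le hb (h.mono fun s hs => hs.norm_le), ?_⟩
  have h1 := ae_integral_le_integral hF (hb.mul_const R) (h.mono fun s hs =>
    hs.ae_le.mono fun x hx => (le_abs_self _).trans hx)
  have h2 := ae_integral_le_integral hF.neg (hb.mul_const R) (h.mono fun s hs => by
    filter_upwards [hs.ae_le, Lp.coeFn_neg (F s)] with x hx h3
    simp only [Pi.neg_apply]
    rw [h3]
    exact (neg_le_abs _).trans hx)
  simp only [Pi.neg_apply, integral_neg, integral_mul_const] at h1 h2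
  filter_upwards [h1, h2, Lp.coeFn_neg (∫ s, F s ∂μ)] with x h1 h2 h3
  rw [h3, Pi.neg_apply] at h2
  exact abs_le.2 ⟨by linarith, h1⟩

theorem heat (h : Controlled B R v) (t : ℝ) : Controlled B R (heat n t v) := by
  rcases le_or_gt t 0 with ht | ht
  · rwa [heat_of_nonpos ht]
  refine ⟨(norm_heat_le t v).trans h.norm_le, ?_⟩
  filter_upwards [coeFn_heat ht v] with x hx
  rw [hx]
  have := abs_kernel_conv_le_of_ae_bound (integrable_gaussKernel n ht) h.ae_le x
  rwa [integral_abs_gaussKernel ht, one_mul] at this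

/-- Only the `L¹` bound and the supremum of the kernel enter; the incoming `R` is forgotten. -/
theorem heat_smoothing (h : Controlled B R v) {t : ℝ} (ht : 0 < t) :
    Controlled B ((4 * Real.pi * t) ^ (-((n : ℝ) / 2))) (_root_.heat n t v) := by
  refine ⟨(norm_heat_le t v).trans h.norm_le, ?_⟩
  filter_upwards [coeFn_heat ht v] with x hx
  rw [hx]
  have := abs_kernel_conv_le_of_bound (integrable_coe_L1 v)
    (B := (4 * Real.pi * t) ^ (-((n : ℝ) / 2))) (k := gaussKernel n t) (fun x => by
      rw [abs_of_nonneg (gaussKernel_nonneg n ht.le x)]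
      exact gaussKernel_le n ht x) x
  refine this.trans ?_
  rw [mul_comm, ← norm_L1_eq]
  have := h.norm_le
  gcongr

theorem heat_add_sub (h : Controlled B R v) (hR : 0 ≤ R) {τ r : ℝ} (hτ : 0 < τ) (hr : 0 ≤ r) :
    Controlled (gaussLip n * √(r / τ) * B) R (_root_.heat n (τ + r) v - _root_.heat n τ v) := by
  have hC := gaussLip_ge n
  refine ⟨(norm_heat_add_sub_le hτ hr v).trans (by have := h.norm_le; gcongr), ?_⟩
  filter_upwards [coeFn_heat_sub (show 0 < τ + r by linarith) hτ v] with x hx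
  rw [hx]
  have h1 := abs_kernel_conv_le_of_ae_bound ((integrable_gaussKernel n (show 0 < τ + r by
    linarith)).sub (integrable_gaussKernel n hτ)) h.ae_le x
  refine h1.trans ?_
  rw [mul_assoc]
  have h2 := integral_abs_gaussKernel_sub_le n hτ hr
  have := h.nonneg
  refine (mul_le_mul_of_nonneg_right h2 (by positivity)).trans_eq (by ring)

/-- This is the source of the gain `s/t`: the `G_{2t}` bound is integrated for the `L¹` part and
maximised for the `L^∞` part. -/
theorem heat_sub_sub (h : Controlled B R v) {s t : ℝ} (hs : 0 ≤ s) (hst : s ≤ t / 2)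
    (ht : 0 < t) :
    Controlled (gaussLip n * (s / t) * B) (t ^ (-((n : ℝ) / 2)))
      (_root_.heat n (t - s) v - _root_.heat n t v) := by
  have hC := gaussLip_ge n
  have hB := h.nonneg
  have hts : 0 < t - s := by linarith
  have hk := abs_gaussKernel_sub_le n hs hst ht
  constructor
  · refine (norm_heat_sub_le_integral hts ht v).trans ?_
    have h1 := integral_mono ((integrable_gaussKernel n hts).sub
      (integrable_gaussKernel n ht)).abs ((integrable_gaussKernel n
        (show 0 < 2 * t by linarith)).const_mul (gaussLip n * (s / t))) hk
    rw [integral_const_mul, integral_gaussKernel n (by linarith), mul_one] at h1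
    have := h.norm_le
    exact mul_le_mul h1 this (norm_nonneg _) (by positivity)
  · have hb : ∀ x, |gaussKernel n (t - s) x - gaussKernel n t x| ≤
        gaussLip n * (s / t) * t ^ (-((n : ℝ) / 2)) := fun x => (hk x).trans (by
      gcongr
      refine (gaussKernel_le n (by linarith) x).trans ?_
      have : (0 : ℝ) ≤ n / 2 := by positivity
      refine Real.rpow_le_rpow_of_nonpos ht ?_ (by linarith)
      nlinarith [Real.pi_gt_three])
    filter_upwards [coeFn_heat_sub hts ht v] with x hx
    rw [hx]
    have h1 := abs_kernel_conv_le_of_bound (integrable_coe_L1 v)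
      (k := fun x => gaussKernel n (t - s) x - gaussKernel n t x) hb x
    refine h1.trans ?_
    rw [← norm_L1_eq]
    have := h.norm_le
    refine (mul_le_mul_of_nonneg_left this (by positivity)).trans_eq (by ring)

end Controlled
end Controlled

/-! ### Strong continuity of the heat semigroup at time zero. -/

section ApproximateIdentity
variable {n : ℕ}

open Filter Topology in
theorem tendsto_integral_translate_sub (v : L1Sp n) :
    ∀ ε > 0, ∃ δ > 0, ∀ y : RSp n, ‖y‖ < δ → ∫ x, |v (x - y) - v x| ≤ ε := by
  intro ε hε
  have hmp : ∀ y : RSp n, MeasurePreserving (fun x : RSp n => x - y) volume volume :=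
    fun y => measurePreserving_sub_right volume y
  let g : RSp n → C(RSp n, RSp n) := fun y => ⟨fun x => x - y, by fun_prop⟩
  have hg : Continuous g := ContinuousMap.continuous_of_continuous_uncurry _ (by
    change Continuous fun p : RSp n × RSp n => p.2 - p.1
    fun_prop)
  have hc : Continuous fun y => Lp.compMeasurePreserving (g y) (hmp y) v :=
    Continuous.compMeasurePreservingLp continuous_const hg hmp ENNReal.one_ne_top
  have h0 : ∀ y, ‖Lp.compMeasurePreserving (g y) (hmp y) v - v‖ = ∫ x, |v (x - y) - v x| := by
    intro y
    rw [norm_L1_eq]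
    refine integral_congr_ae ?_
    filter_upwards [Lp.coeFn_sub (Lp.compMeasurePreserving (g y) (hmp y) v) v,
      Lp.coeFn_compMeasurePreserving v (hmp y)] with x h1 h2
    rw [h1, Pi.sub_apply]
    erw [h2]
    rfl
  have h00 : Lp.compMeasurePreserving (g 0) (hmp 0) v = v := by
    rw [← sub_eq_zero, ← norm_eq_zero, h0]
    simp
  obtain ⟨δ, hδ, h⟩ := Metric.continuous_iff.1 hc 0 ε hε
  refine ⟨δ, hδ, fun y hy => ?_⟩
  have := h y (by simpa using hy)
  rw [h00, dist_eq_norm, h0] at this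
  exact this.le

theorem integrable_heat_difference_kernel {t : ℝ} (ht : 0 < t) (v : L1Sp n) :
    Integrable (fun p : RSp n × RSp n => gaussKernel n t p.2 * (v (p.1 - p.2) - v p.1))
      (volume.prod volume) := by
  have h1 := (integrable_gaussKernel n ht).convolution_integrand (ContinuousLinearMap.mul ℝ ℝ)
    (integrable_coe_L1 v)
  have h2 := (integrable_coe_L1 v).mul_prod (integrable_gaussKernel n ht)
  refine (h1.sub h2).congr (Filter.Eventually.of_forall fun p => ?_)
  simp only [Pi.sub_apply, ContinuousLinearMap.mul_apply']
  ring

/-- As `G_t` has mass one, `e^{tΔ}v - v` is an average of the increments of `v`; Fubini then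
exchanges the two integrations. -/
theorem norm_heat_sub_self_le {t : ℝ} (ht : 0 < t) (v : L1Sp n) :
    ‖heat n t v - v‖ ≤ ∫ y, gaussKernel n t y * ∫ x, |v (x - y) - v x| := by
  have hI := integrable_heat_difference_kernel ht v
  have h1 : ‖heat n t v - v‖ = ∫ x, |∫ y, gaussKernel n t y * (v (x - y) - v x)| := by
    rw [norm_L1_eq]
    refine integral_congr_ae ?_
    filter_upwards [Lp.coeFn_sub (heat n t v) v, coeFn_heat ht v] with x h1 h2
    rw [h1, Pi.sub_apply, h2]
    have h3 : ∫ y, gaussKernel n t (x - y) * v y = ∫ y, gaussKernel n t y * v (x - y) := by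
      rw [← integral_sub_left_eq_self _ volume x]
      simp
    have h4 : v x = ∫ y, gaussKernel n t y * v x := by
      rw [integral_mul_const, integral_gaussKernel n ht, one_mul]
    have i1 : Integrable fun y => gaussKernel n t y * v (x - y) := by
      have := (integrable_gaussKernel_mul (integrable_coe_L1 v) ht x).comp_sub_left x
      simpa using this
    rw [h3]
    conv_lhs => rw [h4]
    rw [← integral_sub i1 ((integrable_gaussKernel n ht).mul_const _)]
    simp only [mul_sub]
  rw [h1]
  calc ∫ x, |∫ y, gaussKernel n t y * (v (x - y) - v x)|
      ≤ ∫ x, ∫ y, |gaussKernel n t y * (v (x - y) - v x)| :=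
        integral_mono hI.integral_prod_left.abs hI.abs.integral_prod_left
          fun x => abs_integral_le_integral_abs
    _ = ∫ y, ∫ x, |gaussKernel n t y * (v (x - y) - v x)| := integral_integral_swap hI.abs
    _ = _ := by
        congr 1 with y
        rw [← integral_const_mul]
        congr 1 with x
        rw [abs_mul, abs_of_nonneg (gaussKernel_nonneg n ht.le y)]

/-- Off the ball, half of the exponent contributes `exp(-δ²/(8t)) ≤ 8t/δ²`, which is small as `t →
0`; the other half keeps an integrable kernel of known mass. -/
theorem gaussKernel_le_of_le_norm {t δ : ℝ} (ht : 0 < t) (hδ : 0 < δ) {y : RSp n}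
    (hy : δ ≤ ‖y‖) :
    gaussKernel n t y ≤ 8 * t / δ ^ 2 * 2 ^ ((n : ℝ) / 2) * gaussKernel n (2 * t) y := by
  unfold gaussKernel
  have e1 : Real.exp (-(‖y‖ ^ 2 / (4 * t))) ≤
      8 * t / δ ^ 2 * Real.exp (-(‖y‖ ^ 2 / (4 * (2 * t)))) := by
    have h1 : -(‖y‖ ^ 2 / (4 * t)) = -(‖y‖ ^ 2 / (8 * t)) + -(‖y‖ ^ 2 / (4 * (2 * t))) := by
      field_simp; ring
    rw [h1, Real.exp_add]
    gcongr
    have h2 := Real.add_one_le_exp (δ ^ 2 / (8 * t))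
    have h3 : Real.exp (-(‖y‖ ^ 2 / (8 * t))) ≤ Real.exp (-(δ ^ 2 / (8 * t))) := by
      rw [Real.exp_le_exp]
      gcongr
    refine h3.trans ?_
    rw [Real.exp_neg, inv_le_comm₀ (Real.exp_pos _) (by positivity), inv_div]
    linarith
  have e2 : (4 * Real.pi * t) ^ (-((n : ℝ) / 2)) =
      2 ^ ((n : ℝ) / 2) * (4 * Real.pi * (2 * t)) ^ (-((n : ℝ) / 2)) := by
    rw [show 4 * Real.pi * (2 * t) = 2 * (4 * Real.pi * t) by ring,
      Real.mul_rpow (x := 2) (y := 4 * Real.pi * t) (by norm_num) (by positivity), ← mul_assoc,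
      ← Real.rpow_add (by norm_num)]
    simp
  rw [e2]
  calc _ ≤ 2 ^ ((n : ℝ) / 2) * (4 * Real.pi * (2 * t)) ^ (-((n : ℝ) / 2)) *
        (8 * t / δ ^ 2 * Real.exp (-(‖y‖ ^ 2 / (4 * (2 * t))))) := by gcongr
    _ = _ := by ring

open Filter Topology in
theorem tendsto_heat_zero (v : L1Sp n) : Tendsto (fun t => heat n t v) (𝓝 0) (𝓝 v) := by
  rw [Metric.tendsto_nhds_nhds]
  intro ε hε
  obtain ⟨δ, hδ, hv⟩ := tendsto_integral_translate_sub v (ε / 3) (by positivity)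
  -- Increments with `‖y‖ ≥ δ` contribute at most `C * t`, which the choice of radius below makes
  -- smaller than `ε/3`; those with `‖y‖ < δ` contribute at most `ε/3`.
  set C := 8 / δ ^ 2 * 2 ^ ((n : ℝ) / 2) * (2 * ‖v‖) with hC
  have hC0 : 0 ≤ C := by positivity
  refine ⟨ε / (3 * (C + 1)), by positivity, fun t ht => ?_⟩
  rw [dist_eq_norm]
  rcases le_or_gt t 0 with h0 | h0
  · simpa [heat_of_nonpos h0] using hε
  rw [Real.dist_eq, sub_zero, abs_of_pos h0, lt_div_iff₀ (by positivity)] at ht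
  have hb : ∀ y : RSp n, ∫ x, |v (x - y) - v x| ≤ 2 * ‖v‖ := fun y => by
    have i1 := (integrable_coe_L1 v).comp_sub_right y
    calc ∫ x, |v (x - y) - v x| ≤ ∫ x, (|v (x - y)| + |v x|) :=
          integral_mono (i1.sub (integrable_coe_L1 v)).abs (i1.abs.add (integrable_coe_L1 v).abs)
            fun x => abs_sub _ _
      _ = 2 * ‖v‖ := by
          rw [integral_add i1.abs (integrable_coe_L1 v).abs,
            integral_sub_right_eq_self (fun x => |v x|), ← norm_L1_eq]
          ring
  have hI := (integrable_heat_difference_kernel h0 v).abs.integral_prod_right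
  have hI' : Integrable fun y => gaussKernel n t y * ∫ x, |v (x - y) - v x| := by
    refine hI.congr (Eventually.of_forall fun y => ?_)
    simp only
    rw [← integral_const_mul]
    congr 1 with x
    rw [abs_mul, abs_of_nonneg (gaussKernel_nonneg n h0.le y)]
  have i2 := (integrable_gaussKernel n h0).const_mul (ε / 3)
  have i3 := (integrable_gaussKernel n (show 0 < 2 * t by linarith)).const_mul (C * t)
  have h1 : ∀ y, gaussKernel n t y * ∫ x, |v (x - y) - v x| ≤
      ε / 3 * gaussKernel n t y + C * t * gaussKernel n (2 * t) y := by
    intro y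
    have g1 := gaussKernel_nonneg n h0.le y
    have g2 := gaussKernel_nonneg n (show 0 ≤ 2 * t by linarith) y
    rcases lt_or_ge ‖y‖ δ with hy | hy
    · have := mul_le_mul_of_nonneg_left (hv y hy) g1
      have : 0 ≤ C * t * gaussKernel n (2 * t) y := by positivity
      linarith
    · have := mul_le_mul (gaussKernel_le_of_le_norm h0 hδ hy) (hb y)
        (integral_nonneg fun x => abs_nonneg _) (by positivity)
      have h5 : 8 * t / δ ^ 2 * 2 ^ ((n : ℝ) / 2) * gaussKernel n (2 * t) y * (2 * ‖v‖) =
          C * t * gaussKernel n (2 * t) y := by rw [hC]; ring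
      have : 0 ≤ ε / 3 * gaussKernel n t y := by positivity
      linarith
  have h2 := (norm_heat_sub_self_le h0 v).trans (integral_mono hI' (i2.add i3) h1)
  simp only [Pi.add_apply] at h2
  rw [integral_add i2 i3, integral_const_mul, integral_const_mul, integral_gaussKernel n h0,
    integral_gaussKernel n (by linarith)] at h2
  nlinarith

open Filter Topology in
theorem continuousOn_heat (v : L1Sp n) : ContinuousOn (fun t => heat n t v) (Ici 0) := by
  intro t ht
  rcases (mem_Ici.1 ht).eq_or_lt with rfl | h0
  · refine ContinuousAt.continuousWithinAt ?_
    have := tendsto_heat_zero v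
    rwa [ContinuousAt, heat_of_nonpos le_rfl]
  · exact (tendsto_heat_of_pos h0 v).mono_left nhdsWithin_le_nhds

end ApproximateIdentity

/-! ### The nonlinearity as a superposition operator. -/

/-- `f` vanishes at the origin and is locally Lipschitz with power growth of exponent `p - 1`. -/
structure PowerLipschitz (f : ℝ → ℝ) (K p : ℝ) : Prop where
  one_lt : 1 < p
  nonneg : 0 ≤ K
  map_zero : f 0 = 0
  lipschitz : ∀ ξ η : ℝ, |f ξ - f η| ≤ K * (|ξ| ^ (p - 1) + |η| ^ (p - 1)) * |ξ - η|

namespace PowerLipschitz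
variable {n : ℕ} {f : ℝ → ℝ} {K p B B' D R : ℝ} {v w : L1Sp n}

theorem sub_one_pos (hf : PowerLipschitz f K p) : 0 < p - 1 := by linarith [hf.one_lt]

open Filter Topology in
theorem continuous (hf : PowerLipschitz f K p) : Continuous f := by
  have hp := hf.sub_one_pos
  refine continuous_iff_continuousAt.2 fun η => ?_
  rw [ContinuousAt, tendsto_iff_norm_sub_tendsto_zero]
  have hc : Continuous fun ξ : ℝ => K * (|ξ| ^ (p - 1) + |η| ^ (p - 1)) * |ξ - η| := by
    have : Continuous fun ξ : ℝ => |ξ| ^ (p - 1) := continuous_abs.rpow_const fun _ => Or.inr hp.le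
    fun_prop
  have := hc.tendsto η
  simp only [sub_self, abs_zero, mul_zero] at this
  exact squeeze_zero (fun _ => norm_nonneg _) (fun ξ => hf.lipschitz ξ η) this

theorem abs_sub_le (hf : PowerLipschitz f K p) {ξ η b b' : ℝ} (hξ : |ξ| ≤ b) (hη : |η| ≤ b') :
    |f ξ - f η| ≤ K * (b ^ (p - 1) + b' ^ (p - 1)) * |ξ - η| := by
  have := hf.nonneg
  have := hf.sub_one_pos
  exact (hf.lipschitz ξ η).trans (by gcongr)

theorem integrable_comp (hf : PowerLipschitz f K p) (hv : Controlled B R v) :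
    Integrable fun x => f (v x) := by
  have hp := hf.sub_one_pos
  refine Integrable.mono' ((integrable_coe_L1 v).abs.const_mul (K * (B * R) ^ (p - 1)))
    (hf.continuous.comp_aestronglyMeasurable (Lp.aestronglyMeasurable v)) ?_
  filter_upwards [hv.ae_le] with x hx
  simpa [hf.map_zero, Real.zero_rpow hp.ne'] using
    hf.abs_sub_le hx (show |(0 : ℝ)| ≤ 0 by simp)

theorem coeFn_superpos (hf : PowerLipschitz f K p) (hv : Controlled B R v) :
    superpos n f v =ᵐ[volume] fun x => f (v x) := by
  rw [superpos, dif_pos (hf.integrable_comp hv)]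
  exact Integrable.coeFn_toL1 _

theorem ae_superpos_sub_le (hf : PowerLipschitz f K p) (hv : Controlled B R v)
    (hw : Controlled B' R w) : ∀ᵐ x, |(superpos n f v - superpos n f w : L1Sp n) x| ≤
      K * ((B * R) ^ (p - 1) + (B' * R) ^ (p - 1)) * |(v - w : L1Sp n) x| := by
  filter_upwards [hf.coeFn_superpos hv, hf.coeFn_superpos hw, hv.ae_le, hw.ae_le,
    Lp.coeFn_sub v w, Lp.coeFn_sub (superpos n f v) (superpos n f w)] with x h1 h2 h3 h4 h5 h6
  rw [h5, h6, Pi.sub_apply, Pi.sub_apply, h1, h2]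
  exact hf.abs_sub_le h3 h4

theorem norm_superpos_sub_le (hf : PowerLipschitz f K p) (hv : Controlled B R v)
    (hw : Controlled B' R w) : ‖superpos n f v - superpos n f w‖ ≤
      K * ((B * R) ^ (p - 1) + (B' * R) ^ (p - 1)) * ‖v - w‖ := by
  rw [norm_L1_eq, norm_L1_eq, ← integral_const_mul]
  exact integral_mono_ae (integrable_coe_L1 _).abs ((integrable_coe_L1 _).abs.const_mul _)
    (hf.ae_superpos_sub_le hv hw)

/-- The pointwise Lipschitz bound multiplies both norms of `v - w` by the same number, so the ratio
`R` is inherited. This is what allows the estimates to be iterated. -/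
theorem controlled_superpos_sub (hf : PowerLipschitz f K p) (hR : 0 ≤ R)
    (hv : Controlled B R v) (hw : Controlled B' R w) (hvw : Controlled D R (v - w)) :
    Controlled (K * ((B * R) ^ (p - 1) + (B' * R) ^ (p - 1)) * D) R
      (superpos n f v - superpos n f w) := by
  have hK := hf.nonneg
  have hB := hv.nonneg
  have hB' := hw.nonneg
  have hD := hvw.norm_le
  refine ⟨(hf.norm_superpos_sub_le hv hw).trans (by gcongr), ?_⟩
  filter_upwards [hf.ae_superpos_sub_le hv hw, hvw.ae_le] with x h1 h2
  refine h1.trans ?_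
  rw [mul_assoc _ D R]
  gcongr

theorem superpos_zero (hf : PowerLipschitz f K p) : superpos n f 0 = 0 := by
  refine Lp.ext ?_
  filter_upwards [hf.coeFn_superpos (Controlled.zero (n := n) 0),
    Lp.coeFn_zero ℝ 1 (volume : Measure (RSp n))] with x h1 h2
  rw [h1, h2, Pi.zero_apply, hf.map_zero]

theorem controlled_superpos (hf : PowerLipschitz f K p) (hR : 0 ≤ R) (hv : Controlled B R v) :
    Controlled (K * (B * R) ^ (p - 1) * B) R (superpos n f v) := by
  have hp := hf.sub_one_pos
  have := hf.controlled_superpos_sub hR hv (Controlled.zero R) (D := B) (by simpa using hv)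
  simpa [hf.superpos_zero, Real.zero_rpow hp.ne'] using this

open Filter Topology in
theorem continuousOn_superpos (hf : PowerLipschitz f K p) {u : ℝ → L1Sp n} {S : Set ℝ}
    (hu : ContinuousOn u S) (hB : ∀ s ∈ S, Controlled B R (u s)) :
    ContinuousOn (fun s => superpos n f (u s)) S := by
  intro s hs
  rw [ContinuousWithinAt, tendsto_iff_norm_sub_tendsto_zero]
  have h1 := (tendsto_iff_norm_sub_tendsto_zero.1 (hu s hs)).const_mul
    (K * ((B * R) ^ (p - 1) + (B * R) ^ (p - 1)))
  rw [mul_zero] at h1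
  refine squeeze_zero' (Eventually.of_forall fun _ => norm_nonneg _) ?_ h1
  filter_upwards [self_mem_nhdsWithin] with r hr
  exact hf.norm_superpos_sub_le (hB r hr) (hB s hs)

end PowerLipschitz

/-! ### Integrals of time weights and the resulting rates. -/

section TimeWeights

theorem integrableOn_one_add_rpow {a T : ℝ} (ha : 0 < a) (hT : 0 ≤ T) :
    IntegrableOn (fun s : ℝ => (1 + s) ^ (-(1 + a))) (Ioi T) := by
  have := integrableOn_add_rpow_Ioi_of_lt (a := -(1 + a)) (c := T) (m := 1) (by linarith)
    (by linarith)
  simpa only [add_comm] using this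

open Filter Topology in
theorem integral_one_add_rpow {a T : ℝ} (ha : 0 < a) (hT : 0 ≤ T) :
    ∫ s in Ioi T, (1 + s : ℝ) ^ (-(1 + a)) = (1 + T) ^ (-a) / a := by
  have hd : ∀ s ∈ Ici T, HasDerivAt (fun s : ℝ => -((1 + s) ^ (-a) / a))
      ((1 + s) ^ (-(1 + a))) s := by
    intro s hs
    have hs' : 0 < 1 + s := by linarith [mem_Ici.1 hs]
    have h1 : HasDerivAt (fun s : ℝ => 1 + s) 1 s := (hasDerivAt_id s).const_add 1
    have h2 := ((h1.rpow_const (p := -a) (Or.inl hs'.ne')).div_const a).neg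
    refine h2.congr_deriv ?_
    rw [show -a - 1 = -(1 + a) by ring]
    field_simp
  have ht : Tendsto (fun s : ℝ => -((1 + s) ^ (-a) / a)) atTop (𝓝 0) := by
    have h1 : Tendsto (fun s : ℝ => 1 + s) atTop atTop := tendsto_atTop_add_const_left _ _ tendsto_id
    have := (((tendsto_rpow_neg_atTop ha).comp h1).div_const a).neg
    simpa using this
  rw [integral_Ioi_of_hasDerivAt_of_tendsto' hd (integrableOn_one_add_rpow ha hT) ht]
  ring

theorem one_add_rpow_le_one {a s : ℝ} (ha : 0 ≤ a) (hs : 0 ≤ s) : (1 + s) ^ (-a) ≤ 1 :=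
  Real.rpow_le_one_of_one_le_of_nonpos (by linarith) (by linarith)

theorem one_add_rpow_neg_le {a s : ℝ} (ha : 0 ≤ a) (hs : 0 < s) : (1 + s) ^ (-a) ≤ s ^ (-a) :=
  Real.rpow_le_rpow_of_nonpos hs (by linarith) (by linarith)

theorem intervalIntegrable_one_add_rpow (c : ℝ) {t : ℝ} (ht : 0 ≤ t) :
    IntervalIntegrable (fun s : ℝ => (1 + s) ^ c) volume 0 t := by
  refine ContinuousOn.intervalIntegrable ?_
  refine ContinuousOn.rpow_const (by fun_prop) fun s hs => Or.inl ?_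
  rw [uIcc_of_le ht] at hs
  linarith [hs.1]

theorem mul_one_add_rpow_le {a s : ℝ} (hs : 0 ≤ s) :
    s * (1 + s) ^ (-(1 + a)) ≤ (1 + s) ^ (-a) := by
  have h : (1 + s) ^ (-a) = (1 + s) * (1 + s) ^ (-(1 + a)) := by
    rw [show -a = 1 + -(1 + a) by ring, Real.rpow_add (by linarith), Real.rpow_one]
  rw [h]
  gcongr
  linarith

/-- The total mass, weighted by `min(1, s/t)`, of a source decaying like `(1+s)^{-1-a}`. -/
noncomputable def sourceMass (a t : ℝ) : ℝ :=
  (∫ s in Ioc 0 t, s / t * (1 + s) ^ (-(1 + a))) + ∫ s in Ioi t, (1 + s : ℝ) ^ (-(1 + a))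

theorem log_two_le_log_one_add {t : ℝ} (ht : 1 ≤ t) : 1 / 2 ≤ Real.log (1 + t) := by
  have h1 : Real.log 2 ≤ Real.log (1 + t) := Real.log_le_log (by norm_num) (by linarith)
  linarith [Real.log_two_gt_d9]

theorem decayRate_nonneg {a t : ℝ} (ht : 1 ≤ t) : 0 ≤ decayRate a t := by
  have := log_two_le_log_one_add ht
  unfold decayRate
  split_ifs <;> positivity

/-- One factor `1 + s` absorbs `s`, so the near part is at most `t^{-1} ∫₀ᵗ (1+s)^{-a} ds`, whose
behaviour changes at `a = 1`. The tail is at most `t^{-a}/a` and never dominates. -/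
theorem sourceMass_le {a : ℝ} (ha : 0 < a) :
    ∃ C : ℝ, 0 < C ∧ ∀ t, 1 ≤ t → sourceMass a t ≤ C * decayRate a t := by
  have key : ∀ t, 1 ≤ t → sourceMass a t ≤ t⁻¹ * (∫ s in (0 : ℝ)..t, (1 + s) ^ (-a)) + t ^ (-a) / a := by
    intro t ht
    have ht0 : 0 < t := by linarith
    refine add_le_add ?_ ?_
    · rw [intervalIntegral.integral_of_le ht0.le, ← integral_const_mul]
      have i1 : IntegrableOn (fun s : ℝ => t⁻¹ * (1 + s) ^ (-a)) (Ioc 0 t) :=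
        ((intervalIntegrable_one_add_rpow (-a) ht0.le).1).const_mul _
      refine integral_mono_of_nonneg ?_ i1 ?_
      · filter_upwards [ae_restrict_mem measurableSet_Ioc] with s hs
        have : 0 < s := hs.1
        simp only [Pi.zero_apply]
        positivity
      · filter_upwards [ae_restrict_mem measurableSet_Ioc] with s hs
        rw [div_eq_inv_mul, mul_assoc]
        gcongr
        exact mul_one_add_rpow_le hs.1.le
    · rw [integral_one_add_rpow ha ht0.le]
      gcongr ?_ / _
      exact one_add_rpow_neg_le ha.le ht0
  rcases lt_trichotomy a 1 with h1 | h1 | h1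
  · refine ⟨1 / (1 - a) + 1 / a, by have := sub_pos.2 h1; positivity, fun t ht => ?_⟩
    have ht0 : 0 < t := by linarith
    have h2 : ∫ s in (0 : ℝ)..t, (1 + s) ^ (-a) ≤ t ^ (1 - a) / (1 - a) := by
      have h3 : ∫ s in (0 : ℝ)..t, s ^ (-a) = t ^ (1 - a) / (1 - a) := by
        rw [integral_rpow (Or.inl (by linarith)), Real.zero_rpow (by linarith), sub_zero,
          show -a + 1 = 1 - a by ring]
      rw [← h3]
      refine intervalIntegral.integral_mono_on_of_le_Ioo ht0.le
        (intervalIntegrable_one_add_rpow _ ht0.le)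
        (intervalIntegral.intervalIntegrable_rpow' (by linarith)) fun s hs =>
        one_add_rpow_neg_le ha.le hs.1
    rw [decayRate, if_pos h1]
    calc sourceMass a t ≤ _ := key t ht
      _ ≤ t⁻¹ * (t ^ (1 - a) / (1 - a)) + t ^ (-a) / a := by gcongr
      _ = _ := by
        rw [show 1 - a = 1 + -a by ring, Real.rpow_add ht0, Real.rpow_one]
        field_simp
  · subst h1
    -- The near part counts once, and the tail `t^{-1}` at most twice because `log(1+t) ≥ 1/2`.
    refine ⟨3, by norm_num, fun t ht => ?_⟩
    have ht0 : 0 < t := by linarith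
    have h2 : ∫ s in (0 : ℝ)..t, (1 + s) ^ (-1 : ℝ) = Real.log (1 + t) := by
      have h3 := intervalIntegral.integral_comp_add_left (a := 0) (b := t) (fun x : ℝ => x⁻¹) 1
      simp only [Real.rpow_neg_one]
      rw [h3, integral_inv_of_pos (by norm_num) (by linarith)]
      simp
    have h3 := key t ht
    have h4 := log_two_le_log_one_add ht
    rw [h2, Real.rpow_neg_one, div_one] at h3
    rw [decayRate, if_neg (lt_irrefl _), if_pos rfl]
    have : 0 < t⁻¹ := by positivity
    nlinarith
  · refine ⟨1 / (a - 1) + 1 / a, by have := sub_pos.2 h1; positivity, fun t ht => ?_⟩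
    have ha1 : 0 < a - 1 := by linarith
    have ht0 : 0 < t := by linarith
    have h2 : ∫ s in (0 : ℝ)..t, (1 + s) ^ (-a) ≤ 1 / (a - 1) := by
      have h3 := integral_one_add_rpow ha1 le_rfl
      have h5 := integrableOn_one_add_rpow ha1 le_rfl
      rw [show -(1 + (a - 1)) = -a by ring] at h3 h5
      rw [add_zero, Real.one_rpow] at h3
      rw [← h3, intervalIntegral.integral_of_le ht0.le]
      refine setIntegral_mono_set h5 ?_ (LE.le.eventuallyLE Ioc_subset_Ioi_self)
      filter_upwards [ae_restrict_mem measurableSet_Ioi] with s hs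
      have : 0 < s := hs
      simp only [Pi.zero_apply]
      positivity
    have h4 : t ^ (-a) ≤ t⁻¹ := by
      rw [← Real.rpow_neg_one]
      exact Real.rpow_le_rpow_of_exponent_le ht (by linarith)
    rw [decayRate, if_neg h1.not_gt, if_neg h1.ne']
    calc sourceMass a t ≤ _ := key t ht
      _ ≤ t⁻¹ * (1 / (a - 1)) + t⁻¹ / a := by gcongr
      _ = _ := by ring

/-- The rate for exponent `a` dominates a power `t^{-b}`, for every `b ≤ a` with `b < 1`. -/
theorem decayRate_le_rpow {a b : ℝ} (hba : b ≤ a) (hb : b < 1) :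
    ∃ C : ℝ, 0 < C ∧ ∀ t, 1 ≤ t → decayRate a t ≤ C * (1 + t) ^ (-b) := by
  have hmain : ∃ C : ℝ, 0 < C ∧ ∀ t, 1 ≤ t → decayRate a t ≤ C * t ^ (-b) := by
    rcases lt_trichotomy a 1 with h1 | h1 | h1
    · refine ⟨1, one_pos, fun t ht => ?_⟩
      rw [decayRate, if_pos h1, one_mul]
      exact Real.rpow_le_rpow_of_exponent_le ht (by linarith)
    -- The logarithm is absorbed by the spare power: `log(1+t) ≤ (1+t)^{1-b}/(1-b)`.
    · refine ⟨2 / (1 - b) * 2 ^ (1 - b), by have := sub_pos.2 hb; positivity, fun t ht => ?_⟩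
      have hb' : 0 < 1 - b := by linarith
      have ht0 : 0 < t := by linarith
      rw [decayRate, if_neg h1.not_lt, if_pos h1]
      have h2 := Real.log_le_rpow_div (show 0 ≤ 1 + t by linarith) hb'
      have h3 : (1 + t) ^ (1 - b) ≤ 2 ^ (1 - b) * t ^ (1 - b) := by
        rw [← Real.mul_rpow (by norm_num) ht0.le]
        exact Real.rpow_le_rpow (by linarith) (by linarith) hb'.le
      have h4 : t⁻¹ * t ^ (1 - b) = t ^ (-b) := by
        rw [← Real.rpow_neg_one, ← Real.rpow_add ht0]
        congr 1
        ring
      calc t⁻¹ * Real.log (1 + t) ≤ t⁻¹ * (2 ^ (1 - b) * t ^ (1 - b) / (1 - b)) := by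
            gcongr
            exact h2.trans (by gcongr)
        _ = 1 / (1 - b) * 2 ^ (1 - b) * (t⁻¹ * t ^ (1 - b)) := by ring
        _ ≤ _ := by
            rw [h4]
            gcongr
            norm_num
    · refine ⟨1, one_pos, fun t ht => ?_⟩
      rw [decayRate, if_neg h1.not_gt, if_neg h1.ne', one_mul, ← Real.rpow_neg_one]
      exact Real.rpow_le_rpow_of_exponent_le ht (by linarith)
  obtain ⟨C, hC, h⟩ := hmain
  refine ⟨C * max 1 (2 ^ b), by positivity, fun t ht => (h t ht).trans ?_⟩
  have ht0 : 0 < t := by linarith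
  rw [mul_assoc]
  gcongr
  rcases le_total 0 b with h0 | h0
  · have h1 : (2 * t) ^ (-b) ≤ (1 + t) ^ (-b) :=
      Real.rpow_le_rpow_of_nonpos (by linarith) (by linarith) (by linarith)
    rw [Real.mul_rpow (by norm_num) ht0.le, Real.rpow_neg (by norm_num),
      inv_mul_le_iff₀ (by positivity)] at h1
    exact h1.trans (by gcongr; exact le_max_right _ _)
  · have h1 : t ^ (-b) ≤ (1 + t) ^ (-b) :=
      Real.rpow_le_rpow ht0.le (by linarith) (by linarith)
    refine h1.trans (le_mul_of_one_le_left (by positivity) (le_max_left _ _))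

end TimeWeights

/-! ### Duhamel integrals of decaying sources. -/

section Duhamel
variable {n : ℕ} {F : ℝ → L1Sp n} {A B R a t : ℝ}

/-- Since `B` enters both bounds and `R` only one, a constant at least one may be moved from `R` to
`B`. -/
theorem Controlled.of_mul_right {c : ℝ} {v : L1Sp n} (h : Controlled B (c * R) v) (hc : 1 ≤ c) :
    Controlled (c * B) R v :=
  ⟨h.norm_le.trans (le_mul_of_one_le_left h.nonneg hc),
    h.ae_le.mono fun x hx => hx.trans_eq (by ring)⟩

/-- The Duhamel integral `∫₀ᵗ e^{(t-s)Δ} F(s) ds`. -/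
noncomputable def duhamel (F : ℝ → L1Sp n) (t : ℝ) : L1Sp n :=
  ∫ s in (0 : ℝ)..t, heat n (t - s) (F s)

open Filter Topology in
theorem aestronglyMeasurable_heat_source (hF : ContinuousOn F (Ioi 0)) (t : ℝ) :
    AEStronglyMeasurable (fun s => heat n (t - s) (F s)) (volume.restrict (Ioc 0 t)) := by
  -- Dropping the null endpoint `s = t` keeps the heat time `t - s` positive, where continuity in
  -- time is already known.
  rw [← restrict_Ioo_eq_restrict_Ioc]
  refine ContinuousOn.aestronglyMeasurable (fun s hs => ?_) measurableSet_Ioo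
  refine tendsto_heat_uncurry ?_ ((hF s hs.1).mono Ioo_subset_Ioi_self)
  have h1 : Tendsto (fun r : ℝ => t - r) (𝓝[Ioo 0 t] s) (𝓝 (t - s)) :=
    ((continuous_const.sub continuous_id).tendsto s).mono_left nhdsWithin_le_nhds
  exact (tendsto_heat_of_pos (sub_pos.2 hs.2) (F s)).comp h1

theorem integrableOn_heat_source (hF : ContinuousOn F (Ioi 0)) {b : ℝ → ℝ}
    (hb : IntegrableOn b (Ioc 0 t)) (h : ∀ s, 0 < s → ‖F s‖ ≤ b s) :
    IntegrableOn (fun s => heat n (t - s) (F s)) (Ioc 0 t) := by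
  refine Integrable.mono' hb (aestronglyMeasurable_heat_source hF t) ?_
  filter_upwards [ae_restrict_mem measurableSet_Ioc] with s hs
  exact (norm_heat_le _ _).trans (h s hs.1)

theorem integrableOn_heat_source_of_bound (hF : ContinuousOn F (Ioi 0))
    (h : ∀ s, 0 < s → ‖F s‖ ≤ B) :
    IntegrableOn (fun s => heat n (t - s) (F s)) (Ioc 0 t) :=
  integrableOn_heat_source hF (b := fun _ => B) (integrableOn_const (by simp)) h

theorem intervalIntegrable_heat_source_of_bound (hF : ContinuousOn F (Ioi 0))
    (h : ∀ s, 0 < s → ‖F s‖ ≤ B) (ht : 0 ≤ t) :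
    IntervalIntegrable (fun s => heat n (t - s) (F s)) volume 0 t :=
  (intervalIntegrable_iff_integrableOn_Ioc_of_le ht).2 (integrableOn_heat_source_of_bound hF h)

theorem duhamel_sub {F G : ℝ → L1Sp n} (ht : 0 ≤ t) (hF : ContinuousOn F (Ioi 0))
    (hFB : ∀ s, 0 < s → ‖F s‖ ≤ A) (hG : ContinuousOn G (Ioi 0))
    (hGB : ∀ s, 0 < s → ‖G s‖ ≤ B) :
    duhamel (fun s => F s - G s) t = duhamel F t - duhamel G t := by
  unfold duhamel
  simp only [heat_sub]
  exact intervalIntegral.integral_sub (intervalIntegrable_heat_source_of_bound hF hFB ht)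
    (intervalIntegrable_heat_source_of_bound hG hGB ht)

theorem intervalIntegrable_rpow_sub (t : ℝ) :
    IntervalIntegrable (fun s : ℝ => (t - s) ^ (-(1 / 2) : ℝ)) volume 0 t := by
  have := (intervalIntegral.intervalIntegrable_rpow' (a := 0) (b := t)
    (show (-1 : ℝ) < -(1 / 2) by norm_num)).comp_sub_left t
  simpa using this.symm

theorem integral_rpow_sub (t : ℝ) :
    ∫ s in (0 : ℝ)..t, (t - s) ^ (-(1 / 2) : ℝ) = 2 * √t := by
  rw [intervalIntegral.integral_comp_sub_left (fun x : ℝ => x ^ (-(1 / 2) : ℝ)) t, sub_self,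
    sub_zero, integral_rpow (Or.inl (by norm_num)), Real.sqrt_eq_rpow,
    Real.zero_rpow (by norm_num)]
  norm_num
  ring

/-- Hölder continuity in time of the Duhamel integral, in `L¹` and `L^∞`. -/
theorem controlled_duhamel_add_sub (hR : 0 ≤ R) (hF : ContinuousOn F (Ioi 0))
    (hB : ∀ s, 0 < s → Controlled B R (F s)) {h : ℝ} (ht : 0 ≤ t) (hh : 0 ≤ h) :
    Controlled (gaussLip n * √h * (2 * √t) * B + h * B) R
      (duhamel F (t + h) - duhamel F t) := by
  have hnorm : ∀ s, 0 < s → ‖F s‖ ≤ B := fun s hs => (hB s hs).norm_le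
  have i0 := integrableOn_heat_source_of_bound (t := t) hF hnorm
  have i1 := integrableOn_heat_source_of_bound (t := t + h) hF hnorm
  have hth : t ≤ t + h := by linarith
  have i2 := i1.mono_set (Ioc_subset_Ioc_right hth)
  have i3 := i1.mono_set (Ioc_subset_Ioc_left ht)
  have hsplit : duhamel F (t + h) - duhamel F t =
      (∫ s in Ioc 0 t, (heat n (t + h - s) (F s) - heat n (t - s) (F s))) +
        ∫ s in Ioc t (t + h), heat n (t + h - s) (F s) := by
    rw [integral_sub i2 i0]
    unfold duhamel
    rw [← intervalIntegral.integral_add_adjacent_intervals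
      ((intervalIntegrable_iff_integrableOn_Ioc_of_le ht).2 i2)
      ((intervalIntegrable_iff_integrableOn_Ioc_of_le hth).2 i3),
      intervalIntegral.integral_of_le ht, intervalIntegral.integral_of_le ht,
      intervalIntegral.integral_of_le hth]
    abel
  rw [hsplit]
  have j1 : IntegrableOn (fun s => gaussLip n * √h * (t - s) ^ (-(1 / 2) : ℝ) * B) (Ioc 0 t) :=
    ((((intervalIntegrable_iff_integrableOn_Ioc_of_le ht).1
      (intervalIntegrable_rpow_sub t)).const_mul _).mul_const _)
  have c1 := Controlled.integral (R := R) (i2.sub i0) j1 (by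
    rw [← restrict_Ioo_eq_restrict_Ioc]
    filter_upwards [ae_restrict_mem measurableSet_Ioo] with s hs
    have hts : 0 < t - s := sub_pos.2 hs.2
    have := (hB s hs.1).heat_add_sub hR hts hh
    rw [Real.sqrt_div hh, Real.sqrt_eq_rpow (t - s)] at this
    rw [Real.rpow_neg hts.le, mul_assoc (gaussLip n), ← div_eq_mul_inv]
    rwa [show t - s + h = t + h - s by ring] at this)
  have j2 : IntegrableOn (fun _ : ℝ => B) (Ioc t (t + h)) := integrableOn_const (by simp)
  have c2 := Controlled.integral (R := R) i3 j2 (by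
    filter_upwards [ae_restrict_mem measurableSet_Ioc] with s hs
    exact (hB s (ht.trans_lt hs.1)).heat _)
  have e1 : ∫ s in Ioc 0 t, gaussLip n * √h * (t - s) ^ (-(1 / 2) : ℝ) * B =
      gaussLip n * √h * (2 * √t) * B := by
    rw [integral_mul_const, integral_const_mul, ← intervalIntegral.integral_of_le ht,
      integral_rpow_sub t]
  have e2 : ∫ _ in Ioc t (t + h), B = h * B := by
    rw [setIntegral_const, Real.volume_real_Ioc_of_le hth, smul_eq_mul]
    ring
  rw [e1] at c1
  rw [e2] at c2
  exact c1.add c2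

theorem one_le_two_rpow (n : ℕ) : (1 : ℝ) ≤ 2 ^ ((n : ℝ) / 2) :=
  Real.one_le_rpow (by norm_num) (by positivity)

theorem rpow_neg_le_two_rpow_mul {x y : ℝ} (hx : 0 < x) (hy : 0 < y) (hxy : y ≤ 2 * x) :
    x ^ (-((n : ℝ) / 2)) ≤ 2 ^ ((n : ℝ) / 2) * y ^ (-((n : ℝ) / 2)) := by
  have h1 : (2 * x) ^ (-((n : ℝ) / 2)) ≤ y ^ (-((n : ℝ) / 2)) :=
    Real.rpow_le_rpow_of_nonpos hy hxy (by
      have : (0 : ℝ) ≤ n / 2 := by positivity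
      linarith)
  rwa [Real.mul_rpow (by norm_num) hx.le, Real.rpow_neg (by norm_num),
    inv_mul_le_iff₀ (by positivity)] at h1

theorem rpow_four_pi_mul_le {x y : ℝ} (hy : 0 < y) (hxy : y ≤ 4 * Real.pi * x) :
    (4 * Real.pi * x) ^ (-((n : ℝ) / 2)) ≤ y ^ (-((n : ℝ) / 2)) :=
  Real.rpow_le_rpow_of_nonpos hy hxy (by
    have : (0 : ℝ) ≤ n / 2 := by positivity
    linarith)

/-- For `t ≤ 1` the `L^∞` bound of the datum is used, for `t ≥ 1` the smoothing of its `L¹` bound.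
-/
theorem Controlled.heat_decay {v : L1Sp n} (h : Controlled B 1 v) (ht : 0 ≤ t) :
    Controlled (2 ^ ((n : ℝ) / 2) * B) ((1 + t) ^ (-((n : ℝ) / 2))) (_root_.heat n t v) := by
  refine Controlled.of_mul_right ?_ (one_le_two_rpow n)
  rcases le_total t 1 with h1 | h1
  · refine (h.heat t).mono_right ?_
    simpa using rpow_neg_le_two_rpow_mul (n := n) (x := 1) (y := 1 + t) one_pos (by linarith)
      (by linarith)
  · have ht0 : 0 < t := by linarith
    refine (h.heat_smoothing ht0).mono_right ?_
    refine (rpow_four_pi_mul_le (y := 1 + t) (by linarith) ?_).trans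
      (le_mul_of_one_le_left (by positivity) (one_le_two_rpow n))
    nlinarith [Real.pi_gt_three]

/-- A source term continuous in time with values in `L¹`, decaying like `(1+t)^{-1-a}` in `L¹`
and like `(1+t)^{-n/2-1-a}` in `L^∞`. -/
structure DecayingSource (A a : ℝ) (F : ℝ → L1Sp n) : Prop where
  pos : 0 < a
  continuousOn : ContinuousOn F (Ioi 0)
  controlled : ∀ s, 0 < s →
    Controlled (A * (1 + s) ^ (-(1 + a))) ((1 + s) ^ (-((n : ℝ) / 2))) (F s)

namespace DecayingSource

theorem nonneg (hF : DecayingSource A a F) : 0 ≤ A :=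
  nonneg_of_mul_nonneg_left (hF.controlled 1 one_pos).nonneg (by positivity)

theorem controlled_bound (hF : DecayingSource A a F) {s : ℝ} (hs : 0 < s) :
    Controlled A 1 (F s) := by
  have hA := hF.nonneg
  have ha := hF.pos
  exact (hF.controlled s hs).mono
    (mul_le_of_le_one_right hA (one_add_rpow_le_one (by linarith) hs.le))
    (one_add_rpow_le_one (by positivity) hs.le) (by positivity)

theorem integrableOn_weight (hF : DecayingSource A a F) {T : ℝ} (hT : 0 ≤ T) :
    IntegrableOn (fun s : ℝ => A * (1 + s) ^ (-(1 + a))) (Ioi T) :=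
  (integrableOn_one_add_rpow hF.pos hT).const_mul A

theorem integrableOn (hF : DecayingSource A a F) : IntegrableOn F (Ioi 0) := by
  refine Integrable.mono' (hF.integrableOn_weight le_rfl)
    (hF.continuousOn.aestronglyMeasurable measurableSet_Ioi) ?_
  filter_upwards [ae_restrict_mem measurableSet_Ioi] with s hs
  exact (hF.controlled s hs).norm_le

theorem controlled_integral (hF : DecayingSource A a F) :
    Controlled (A / a) 1 (∫ s in Ioi 0, F s) := by
  have h := Controlled.integral (R := 1) hF.integrableOn (hF.integrableOn_weight le_rfl) (by
    filter_upwards [ae_restrict_mem measurableSet_Ioi] with s hs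
    exact (hF.controlled s hs).mono_right (one_add_rpow_le_one (by positivity) (le_of_lt hs)))
  rw [integral_const_mul, integral_one_add_rpow hF.pos le_rfl, add_zero, Real.one_rpow] at h
  convert h using 1
  ring

theorem intervalIntegrable (hF : DecayingSource A a F) (ht : 0 ≤ t) :
    IntervalIntegrable (fun s => heat n (t - s) (F s)) volume 0 t :=
  intervalIntegrable_heat_source_of_bound hF.continuousOn
    (fun _ hs => (hF.controlled_bound hs).norm_le) ht

/-- When `1 + t ≤ 2(1+s)` the source itself already has the required `L^∞` decay. Otherwise `t - s ≥
(1+t)/2` and the smoothing over that time supplies it. No singularity at `s = t` arises. -/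
theorem controlled_heat_source (hF : DecayingSource A a F) {s : ℝ} (hs : 0 < s) (hst : s < t) :
    Controlled (A * (1 + s) ^ (-(1 + a))) (2 ^ ((n : ℝ) / 2) * (1 + t) ^ (-((n : ℝ) / 2)))
      (heat n (t - s) (F s)) := by
  have ht : 0 < t := hs.trans hst
  rcases le_total (1 + t) (2 * (1 + s)) with h | h
  · exact ((hF.controlled s hs).heat _).mono_right
      (rpow_neg_le_two_rpow_mul (by linarith) (by linarith) h)
  · refine ((hF.controlled s hs).heat_smoothing (sub_pos.2 hst)).mono_right ?_
    refine (rpow_four_pi_mul_le (y := 1 + t) (by linarith) ?_).trans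
      (le_mul_of_one_le_left (by positivity) (one_le_two_rpow n))
    nlinarith [Real.pi_gt_three]

theorem controlled_duhamel (hF : DecayingSource A a F) (ht : 0 ≤ t) :
    Controlled (2 ^ ((n : ℝ) / 2) * (A / a)) ((1 + t) ^ (-((n : ℝ) / 2))) (duhamel F t) := by
  have hA := hF.nonneg
  have ha := hF.pos
  have i1 := (hF.integrableOn_weight le_rfl).mono_set (Ioc_subset_Ioi_self (a := t) (b := 0))
  have h := Controlled.integral ((intervalIntegrable_iff_integrableOn_Ioc_of_le ht).1
    (hF.intervalIntegrable ht)) i1 (by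
    rw [← restrict_Ioo_eq_restrict_Ioc]
    filter_upwards [ae_restrict_mem measurableSet_Ioo] with s hs
    exact hF.controlled_heat_source hs.1 hs.2)
  rw [duhamel, intervalIntegral.integral_of_le ht]
  refine Controlled.of_mul_right (h.mono_left ?_ (by positivity)) (one_le_two_rpow n)
  have h2 : ∫ s in Ioc 0 t, A * (1 + s : ℝ) ^ (-(1 + a)) ≤
      ∫ s in Ioi 0, A * (1 + s : ℝ) ^ (-(1 + a)) := by
    refine setIntegral_mono_set (hF.integrableOn_weight le_rfl) ?_
      (LE.le.eventuallyLE Ioc_subset_Ioi_self)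
    filter_upwards [ae_restrict_mem measurableSet_Ioi] with s hs
    have : 0 < s := hs
    simp only [Pi.zero_apply]
    positivity
  refine h2.trans_eq ?_
  rw [integral_const_mul, integral_one_add_rpow hF.pos le_rfl, add_zero, Real.one_rpow]
  ring

/-- For `s ≤ t/2` the cancellation between kernels gives `s/t`. For `s ≥ t/2` the two terms are
bounded separately: `s/t ≥ 1/2` and `gaussLip n ≥ 4`, so the claimed constant covers their sum. -/
theorem controlled_heat_source_sub (hF : DecayingSource A a F) {s : ℝ} (hs : 0 < s)
    (hst : s < t) :
    Controlled (gaussLip n * (s / t * (A * (1 + s) ^ (-(1 + a)))))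
      (2 ^ ((n : ℝ) / 2) * t ^ (-((n : ℝ) / 2)))
      (heat n (t - s) (F s) - heat n t (F s)) := by
  have ht : 0 < t := hs.trans hst
  have hA := hF.nonneg
  have hC := gaussLip_ge n
  rcases le_total s (t / 2) with h | h
  · have := (hF.controlled s hs).heat_sub_sub hs.le h ht
    rw [mul_assoc] at this
    exact this.mono_right (le_mul_of_one_le_left (by positivity) (one_le_two_rpow n))
  · have h1 : Controlled (A * (1 + s) ^ (-(1 + a))) (2 ^ ((n : ℝ) / 2) * t ^ (-((n : ℝ) / 2)))
        (heat n (t - s) (F s)) :=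
      ((hF.controlled s hs).heat _).mono_right
        (rpow_neg_le_two_rpow_mul (by linarith) ht (by linarith))
    have h2 : Controlled (A * (1 + s) ^ (-(1 + a))) (2 ^ ((n : ℝ) / 2) * t ^ (-((n : ℝ) / 2)))
        (heat n t (F s)) :=
      ((hF.controlled s hs).heat_smoothing ht).mono_right
        ((rpow_four_pi_mul_le ht (by nlinarith [Real.pi_gt_three])).trans
          (le_mul_of_one_le_left (by positivity) (one_le_two_rpow n)))
    refine (h1.sub h2).mono_left ?_ (by positivity)
    have h3 : 1 / 2 ≤ s / t := by
      rw [div_le_div_iff₀ two_pos ht]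
      linarith
    have h4 : 2 ≤ gaussLip n * (s / t) := by nlinarith
    have h5 : 0 ≤ A * (1 + s) ^ (-(1 + a)) := by positivity
    rw [← mul_assoc]
    nlinarith

/-- For large times the Duhamel integral behaves like the heat flow of the total mass. -/
theorem controlled_duhamel_sub_heat (hF : DecayingSource A a F) (ht : 0 < t) :
    Controlled (gaussLip n * A * sourceMass a t) (2 ^ ((n : ℝ) / 2) * t ^ (-((n : ℝ) / 2)))
      (duhamel F t - heat n t (∫ s in Ioi 0, F s)) := by
  have hA := hF.nonneg
  have hC := gaussLip_ge n
  have i0 := (heatCLM n t).integrable_comp hF.integrableOn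
  simp only [heatCLM_apply] at i0
  have i1 : IntegrableOn (fun s => heat n t (F s)) (Ioc 0 t) :=
    IntegrableOn.mono_set i0 Ioc_subset_Ioi_self
  have i2 : IntegrableOn (fun s => heat n t (F s)) (Ioi t) :=
    IntegrableOn.mono_set i0 (Ioi_subset_Ioi ht.le)
  have i3 := (intervalIntegrable_iff_integrableOn_Ioc_of_le ht.le).1
    (hF.intervalIntegrable ht.le)
  -- The mass emitted after time `t` is absent from the Duhamel integral and is estimated on its own
  -- as a tail.
  have hsplit : duhamel F t - heat n t (∫ s in Ioi 0, F s) =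
      (∫ s in Ioc 0 t, (heat n (t - s) (F s) - heat n t (F s))) -
        ∫ s in Ioi t, heat n t (F s) := by
    have h1 := (heatCLM n t).integral_comp_comm hF.integrableOn
    simp only [heatCLM_apply] at h1
    rw [← h1, integral_sub i3 i1, ← Ioc_union_Ioi_eq_Ioi ht.le,
      setIntegral_union Ioc_disjoint_Ioi_same measurableSet_Ioi i1 i2, duhamel,
      intervalIntegral.integral_of_le ht.le]
    abel
  have j1 : IntegrableOn (fun s : ℝ => gaussLip n * (s / t * (A * (1 + s) ^ (-(1 + a)))))
      (Ioc 0 t) := by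
    refine ((IntervalIntegrable.continuousOn_mul (intervalIntegrable_one_add_rpow (-(1 + a)) ht.le)
      (g := fun s => s / t) (by fun_prop)).1.const_mul (gaussLip n * A)).congr ?_
    exact Filter.Eventually.of_forall fun s => by simp only; ring
  have c1 := Controlled.integral (i3.sub i1) j1 (by
    rw [← restrict_Ioo_eq_restrict_Ioc]
    filter_upwards [ae_restrict_mem measurableSet_Ioo] with s hs
    exact hF.controlled_heat_source_sub hs.1 hs.2)
  have c2 := Controlled.integral (R := 2 ^ ((n : ℝ) / 2) * t ^ (-((n : ℝ) / 2))) i2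
    (hF.integrableOn_weight ht.le) (by
    filter_upwards [ae_restrict_mem measurableSet_Ioi] with s hs
    have hs0 : 0 < s := ht.trans hs
    exact ((hF.controlled s hs0).heat_smoothing ht).mono_right
      ((rpow_four_pi_mul_le ht (by nlinarith [Real.pi_gt_three])).trans
        (le_mul_of_one_le_left (by positivity) (one_le_two_rpow n))))
  rw [hsplit]
  refine (c1.sub c2).mono_left ?_ (by positivity)
  have e1 : ∫ s in Ioc 0 t, gaussLip n * (s / t * (A * (1 + s) ^ (-(1 + a)))) =
      gaussLip n * A * ∫ s in Ioc 0 t, s / t * (1 + s) ^ (-(1 + a)) := by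
    rw [← integral_const_mul]
    congr 1 with s
    ring
  rw [e1, integral_const_mul, sourceMass, mul_add]
  have h0 : 0 ≤ ∫ s in Ioi t, (1 + s : ℝ) ^ (-(1 + a)) := by
    rw [integral_one_add_rpow hF.pos ht.le]
    have := hF.pos
    positivity
  -- The tail carries only the constant `A`, which is enlarged to `gaussLip n * A`.
  gcongr
  nlinarith

end DecayingSource
end Duhamel

/-! ### Continuity in time of heat flows and Duhamel integrals. -/

section Continuity
variable {n : ℕ} {F : ℝ → L1Sp n} {B R : ℝ}

theorem Controlled.sub_comm {v w : L1Sp n} (h : Controlled B R (v - w)) :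
    Controlled B R (w - v) := by
  simpa using h.neg

theorem Controlled.heat_sub_heat {v : L1Sp n} (h : Controlled B R v) (hR : 0 ≤ R) {t t' : ℝ}
    (ht : 0 < t) (ht' : 0 < t') :
    Controlled (gaussLip n * √(|t - t'| / min t t') * B) R
      (_root_.heat n t v - _root_.heat n t' v) := by
  rcases le_total t t' with hle | hle
  · rw [min_eq_left hle, abs_sub_comm, abs_of_nonneg (sub_nonneg.2 hle)]
    have := (h.heat_add_sub hR ht (sub_nonneg.2 hle)).sub_comm
    rwa [add_sub_cancel] at this
  · rw [min_eq_right hle, abs_of_nonneg (sub_nonneg.2 hle)]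
    have := h.heat_add_sub hR ht' (sub_nonneg.2 hle)
    rwa [add_sub_cancel] at this

/-- The modulus of continuity of the Duhamel integral of a source bounded by `B`. -/
noncomputable def duhamelModulus (n : ℕ) (B t t' : ℝ) : ℝ :=
  gaussLip n * √|t - t'| * (2 * √(min t t')) * B + |t - t'| * B

theorem controlled_duhamel_sub_duhamel (hR : 0 ≤ R) (hF : ContinuousOn F (Ioi 0))
    (hB : ∀ s, 0 < s → Controlled B R (F s)) {t t' : ℝ} (ht : 0 ≤ t) (ht' : 0 ≤ t') :
    Controlled (duhamelModulus n B t t') R (duhamel F t - duhamel F t') := by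
  unfold duhamelModulus
  rcases le_total t t' with hle | hle
  · have := (controlled_duhamel_add_sub hR hF hB ht (sub_nonneg.2 hle)).sub_comm
    rw [add_sub_cancel] at this
    rwa [min_eq_left hle, abs_sub_comm, abs_of_nonneg (sub_nonneg.2 hle)]
  · have := controlled_duhamel_add_sub hR hF hB ht' (sub_nonneg.2 hle)
    rw [add_sub_cancel] at this
    rwa [min_eq_right hle, abs_of_nonneg (sub_nonneg.2 hle)]

open Filter Topology in
theorem tendsto_duhamelModulus (n : ℕ) (B t₀ : ℝ) :
    Tendsto (fun t => duhamelModulus n B t t₀) (𝓝 t₀) (𝓝 0) := by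
  have : Continuous fun t => duhamelModulus n B t t₀ := by
    unfold duhamelModulus
    fun_prop
  simpa [duhamelModulus] using this.tendsto t₀

open Filter Topology in
theorem continuousOn_duhamel (hF : ContinuousOn F (Ioi 0))
    (hB : ∀ s, 0 < s → Controlled B 1 (F s)) : ContinuousOn (duhamel F) (Ici 0) := by
  intro t₀ ht₀
  rw [ContinuousWithinAt, tendsto_iff_norm_sub_tendsto_zero]
  refine squeeze_zero' (Eventually.of_forall fun _ => norm_nonneg _) ?_
    ((tendsto_duhamelModulus n B t₀).mono_left nhdsWithin_le_nhds)
  filter_upwards [self_mem_nhdsWithin] with t ht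
  exact (controlled_duhamel_sub_duhamel zero_le_one hF hB ht ht₀).norm_le

theorem norm_duhamel_le {b : ℝ → ℝ} {t : ℝ} (ht : 0 ≤ t) (hb : IntegrableOn b (Ioc 0 t))
    (h : ∀ s ∈ Ioc 0 t, ‖F s‖ ≤ b s) : ‖duhamel F t‖ ≤ ∫ s in Ioc 0 t, b s := by
  rw [duhamel, intervalIntegral.integral_of_le ht]
  refine norm_integral_le_of_norm_le hb ?_
  filter_upwards [ae_restrict_mem measurableSet_Ioc] with s hs
  exact (norm_heat_le _ _).trans (h s hs)

end Continuity

/-! ### Passage between the paired bounds, `L^q` norms and the solution space. -/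

section Conversion
variable {n : ℕ} {B R : ℝ} {v : L1Sp n}

-- Convergence in `L¹` gives an a.e. convergent subsequence, which preserves the `L^∞` bound. Hence
-- the set on which the contraction acts is complete for the `L¹` distance alone.
open Filter Topology in
theorem isClosed_setOf_controlled (B R : ℝ) : IsClosed {v : L1Sp n | Controlled B R v} := by
  refine IsSeqClosed.isClosed fun v w hv hvw => ⟨?_, ?_⟩
  · exact le_of_tendsto hvw.norm (Eventually.of_forall fun k => (hv k).norm_le)
  · obtain ⟨ns, _, hns⟩ := (tendstoInMeasure_of_tendsto_Lp hvw).exists_seq_tendsto_ae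
    filter_upwards [hns, ae_all_iff.2 fun k => (hv k).ae_le] with x hx hb
    exact le_of_tendsto hx.abs (Eventually.of_forall fun k => hb _)

theorem Controlled.memLp_top (h : Controlled B R v) : MemLp v ⊤ volume :=
  memLp_top_of_bound (Lp.aestronglyMeasurable v) _ h.ae_le

theorem eLpNorm_top_le_of_ae_bound {g : RSp n → ℝ} {C : ℝ} (h : ∀ᵐ x, |g x| ≤ C) :
    eLpNorm g ⊤ volume ≤ ENNReal.ofReal C := by
  rw [eLpNorm_exponent_top]
  exact eLpNormEssSup_le_of_ae_bound h

theorem norm_Linf_le_of_ae_bound {w : LinfSp n} {C : ℝ} (hC : 0 ≤ C) (h : ∀ᵐ x, |w x| ≤ C) :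
    ‖w‖ ≤ C := by
  rw [Lp.norm_def]
  exact ENNReal.toReal_le_of_le_ofReal hC (eLpNorm_top_le_of_ae_bound h)

theorem ae_abs_le_norm_Linf (w : LinfSp n) : ∀ᵐ x, |w x| ≤ ‖w‖ := by
  filter_upwards [ae_le_eLpNormEssSup (f := (w : RSp n → ℝ)) (μ := volume)] with x hx
  rw [Lp.norm_def, ← Real.norm_eq_abs, ← toReal_enorm, eLpNorm_exponent_top]
  refine ENNReal.toReal_mono ?_ hx
  rw [← eLpNorm_exponent_top]
  exact (Lp.memLp w).2.ne

theorem eLpNorm_one_eq (v : L1Sp n) : eLpNorm v 1 volume = ENNReal.ofReal ‖v‖ := by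
  rw [Lp.norm_def, ENNReal.ofReal_toReal (Lp.memLp v).2.ne]

theorem controlled_of_eLpNorm_le {ε : ℝ} (hε : 0 ≤ ε)
    (h : eLpNorm v 1 volume + eLpNorm v ⊤ volume ≤ ENNReal.ofReal ε) : Controlled ε 1 v := by
  have h1 : eLpNorm v 1 volume ≤ ENNReal.ofReal ε := le_self_add.trans h
  have h2 : eLpNorm v ⊤ volume ≤ ENNReal.ofReal ε := le_add_self.trans h
  constructor
  · rw [eLpNorm_one_eq] at h1
    exact (ENNReal.ofReal_le_ofReal_iff hε).1 h1
  · rw [eLpNorm_exponent_top] at h2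
    filter_upwards [ae_le_eLpNormEssSup (f := (v : RSp n → ℝ)) (μ := volume)] with x hx
    rw [mul_one, ← Real.norm_eq_abs, ← toReal_enorm]
    exact ENNReal.toReal_le_of_le_ofReal hε (hx.trans h2)

open Filter Topology in
/-- A curve in `L¹` which is bounded in `L¹ ∩ L^∞` and continuous in `L¹` on `[0,∞)` and in
`L^∞` on `(0,∞)` belongs to the solution space. -/
theorem memX_of_controlled {u : ℝ → L1Sp n} {M : ℝ} (hu : ContinuousOn u (Ici 0))
    (hM : ∀ t, 0 ≤ t → Controlled M 1 (u t))
    (hm : ∀ t₀, 0 < t₀ → ∃ m : ℝ → ℝ, Tendsto m (𝓝 t₀) (𝓝 0) ∧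
      ∀ t, 0 < t → Controlled (m t) 1 (u t - u t₀)) : MemX n u := by
  classical
  refine ⟨⟨hu, M, fun t ht => (hM t ht).norm_le⟩, ?_⟩
  let w : ℝ → LinfSp n := fun t => if h : MemLp (u t) ⊤ volume then h.toLp else 0
  have hw : ∀ t, 0 < t → w t =ᵐ[volume] u t := fun t ht => by
    simp only [w]
    rw [dif_pos (hM t ht.le).memLp_top]
    exact MemLp.coeFn_toLp _
  refine ⟨w, hw, fun t₀ ht₀ => ?_, M, fun t ht => ?_⟩
  · obtain ⟨m, hm0, hmt⟩ := hm t₀ ht₀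
    rw [ContinuousWithinAt, tendsto_iff_norm_sub_tendsto_zero]
    refine squeeze_zero' (Eventually.of_forall fun _ => norm_nonneg _) ?_
      (hm0.mono_left nhdsWithin_le_nhds)
    filter_upwards [self_mem_nhdsWithin] with t ht
    refine norm_Linf_le_of_ae_bound (hmt t ht).nonneg ?_
    filter_upwards [hw t ht, hw t₀ ht₀, (hmt t ht).ae_le, Lp.coeFn_sub (w t) (w t₀),
      Lp.coeFn_sub (u t) (u t₀)] with x h1 h2 h3 h4 h5
    rwa [h4, Pi.sub_apply, h1, h2, ← Pi.sub_apply, ← h5, ← mul_one (m t)]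
  · refine norm_Linf_le_of_ae_bound (hM t ht.le).nonneg ?_
    filter_upwards [hw t ht, (hM t ht.le).ae_le] with x h1 h2
    rwa [h1, ← mul_one M]

theorem MemX.exists_controlled {u : ℝ → L1Sp n} (hu : MemX n u) :
    ∃ M, ∀ t, 0 < t → Controlled M 1 (u t) := by
  obtain ⟨⟨_, M, hM⟩, w, hw, _, M', hM'⟩ := hu
  refine ⟨max M M', fun t ht => ⟨(hM t ht.le).trans (le_max_left _ _), ?_⟩⟩
  filter_upwards [hw t ht, ae_abs_le_norm_Linf (w t)] with x h1 h2
  rw [← h1, mul_one]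
  exact h2.trans ((hM' t ht).trans (le_max_right _ _))

/-- Interpolation between `L¹` and `L^∞`. -/
theorem Controlled.eLpNorm_le (h : Controlled B R v) (hR : 0 < R) {q : ENNReal} (hq : 1 ≤ q) :
    eLpNorm v q volume ≤ ENNReal.ofReal (B * R ^ (1 - q⁻¹.toReal)) := by
  have hB := h.nonneg
  rcases eq_or_ne q ⊤ with rfl | hqt
  · simpa using eLpNorm_top_le_of_ae_bound h.ae_le
  have hq0 : q ≠ 0 := (zero_lt_one.trans_le hq).ne'
  have hq1 : 1 ≤ q.toReal := by
    rw [← ENNReal.toReal_one]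
    exact ENNReal.toReal_mono hqt hq
  have hqp : 0 < q.toReal := by linarith
  rw [eLpNorm_eq_lintegral_rpow_enorm_toReal hq0 hqt, one_div, ENNReal.toReal_inv]
  have h1 : ∫⁻ x, ‖v x‖ₑ ^ q.toReal ≤
      ENNReal.ofReal ((B * R) ^ (q.toReal - 1)) * ENNReal.ofReal B := by
    have h2 : ∫⁻ x, ‖v x‖ₑ ≤ ENNReal.ofReal B := by
      rw [← eLpNorm_one_eq_lintegral_enorm, eLpNorm_one_eq]
      exact ENNReal.ofReal_le_ofReal h.norm_le
    calc ∫⁻ x, ‖v x‖ₑ ^ q.toReal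
        ≤ ∫⁻ x, ENNReal.ofReal ((B * R) ^ (q.toReal - 1)) * ‖v x‖ₑ := by
          refine lintegral_mono_ae ?_
          filter_upwards [h.ae_le] with x hx
          rw [← ofReal_norm, ENNReal.ofReal_rpow_of_nonneg (norm_nonneg _) hqp.le,
            ← ENNReal.ofReal_mul (by positivity)]
          refine ENNReal.ofReal_le_ofReal ?_
          rw [Real.norm_eq_abs]
          rcases (abs_nonneg (v x)).eq_or_lt with h0 | h0
          · rw [← h0, Real.zero_rpow hqp.ne', mul_zero]
          · calc |v x| ^ q.toReal = |v x| ^ (q.toReal - 1) * |v x| := by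
                  rw [← Real.rpow_add_one h0.ne', sub_add_cancel]
              _ ≤ _ := by
                  gcongr
      _ = ENNReal.ofReal ((B * R) ^ (q.toReal - 1)) * ∫⁻ x, ‖v x‖ₑ :=
          lintegral_const_mul' _ _ ENNReal.ofReal_ne_top
      _ ≤ _ := by gcongr
  refine (ENNReal.rpow_le_rpow h1 (by positivity)).trans_eq ?_
  rw [← ENNReal.ofReal_mul (by positivity), ENNReal.ofReal_rpow_of_nonneg (by positivity)
    (by positivity)]
  congr 1
  rcases hB.eq_or_lt with h0 | h0
  · rw [← h0]
    simp [Real.zero_rpow (inv_ne_zero hqp.ne')]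
  · rw [Real.mul_rpow h0.le hR.le, mul_right_comm, ← Real.rpow_add_one h0.ne', sub_add_cancel,
      Real.mul_rpow (by positivity) (by positivity), ← Real.rpow_mul h0.le,
      ← Real.rpow_mul hR.le, mul_inv_cancel₀ hqp.ne', Real.rpow_one, sub_mul, one_mul,
      mul_inv_cancel₀ hqp.ne']

end Conversion

/-! ### Decaying orbits and global existence for small data. -/

/-- A curve in `L¹` on `(0,∞)` with the decay `‖u(t)‖₁ ≤ M`, `‖u(t)‖_∞ ≤ M (1+t)^{-n/2}`
of the heat flow. -/
structure DecayingOrbit {n : ℕ} (M : ℝ) (u : ℝ → L1Sp n) : Prop where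
  continuousOn : ContinuousOn u (Ioi 0)
  controlled : ∀ t, 0 < t → Controlled M ((1 + t) ^ (-((n : ℝ) / 2))) (u t)

namespace DecayingOrbit
variable {n : ℕ} {M M' : ℝ} {u v : ℝ → L1Sp n}

theorem nonneg (hu : DecayingOrbit M u) : 0 ≤ M := (hu.controlled 1 one_pos).nonneg

theorem zero : DecayingOrbit 0 (fun _ => (0 : L1Sp n)) :=
  ⟨continuousOn_const, fun _ _ => Controlled.zero _⟩

theorem controlled_one (hu : DecayingOrbit M u) {t : ℝ} (ht : 0 < t) : Controlled M 1 (u t) :=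
  (hu.controlled t ht).mono_right (one_add_rpow_le_one (by positivity) ht.le)

theorem mono (hu : DecayingOrbit M u) (h : M ≤ M') : DecayingOrbit M' u :=
  ⟨hu.continuousOn, fun t ht => (hu.controlled t ht).mono_left h (by positivity)⟩

/-- The heat flow of a bounded integrable datum plus a Duhamel integral. -/
theorem heat_add_duhamel {F : ℝ → L1Sp n} {φ : L1Sp n} {B A a : ℝ} (hφ : Controlled B 1 φ)
    (hF : DecayingSource A a F) :
    DecayingOrbit (2 ^ ((n : ℝ) / 2) * (B + A / a)) (fun t => heat n t φ + duhamel F t) := by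
  refine ⟨?_, fun t ht => ?_⟩
  · exact ((continuousOn_heat φ).add (continuousOn_duhamel hF.continuousOn
      fun s hs => hF.controlled_bound hs)).mono Ioi_subset_Ici_self
  · rw [mul_add]
    exact (hφ.heat_decay ht.le).add (hF.controlled_duhamel ht.le)

end DecayingOrbit

namespace PowerLipschitz
variable {n : ℕ} {f : ℝ → ℝ} {K p σ M D b : ℝ} {u v : ℝ → L1Sp n}

theorem weight_rpow (hσ : (n : ℝ) / 2 * (p - 1) = 1 + σ) (hM : 0 ≤ M) {s : ℝ} (hs : 0 ≤ s) :
    (M * (1 + s) ^ (-((n : ℝ) / 2))) ^ (p - 1) = M ^ (p - 1) * (1 + s) ^ (-(1 + σ)) := by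
  rw [Real.mul_rpow hM (by positivity), ← Real.rpow_mul (by linarith), neg_mul, hσ]

/-- The decay `b` of `u - v` is multiplied by the Lipschitz factor, of order `(1+s)^{-1-σ}` along
decaying orbits; the exponents add. -/
theorem decayingSource_sub (hf : PowerLipschitz f K p) (hσ : (n : ℝ) / 2 * (p - 1) = 1 + σ)
    (hb : 0 < σ + b) (hu : DecayingOrbit M u) (hv : DecayingOrbit M v)
    (huv : ∀ s, 0 < s →
      Controlled (D * (1 + s) ^ (-b)) ((1 + s) ^ (-((n : ℝ) / 2))) (u s - v s)) :
    DecayingSource (2 * K * M ^ (p - 1) * D) (σ + b)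
      (fun s => superpos n f (u s) - superpos n f (v s)) := by
  refine ⟨hb, ?_, fun s hs => ?_⟩
  · exact (hf.continuousOn_superpos hu.continuousOn fun s hs => hu.controlled_one hs).sub
      (hf.continuousOn_superpos hv.continuousOn fun s hs => hv.controlled_one hs)
  · have := hf.controlled_superpos_sub (by positivity) (hu.controlled s hs) (hv.controlled s hs)
      (huv s hs)
    convert this using 1
    rw [weight_rpow hσ hu.nonneg hs.le, show -(1 + (σ + b)) = -(1 + σ) + -b by ring,
      Real.rpow_add (by linarith)]
    ring

theorem decayingSource (hf : PowerLipschitz f K p) (hσ : (n : ℝ) / 2 * (p - 1) = 1 + σ)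
    (hσ0 : 0 < σ) (hu : DecayingOrbit M u) :
    DecayingSource (K * M ^ (p - 1) * M) σ (fun s => superpos n f (u s)) := by
  refine ⟨hσ0, hf.continuousOn_superpos hu.continuousOn fun s hs => hu.controlled_one hs,
    fun s hs => ?_⟩
  have := hf.controlled_superpos (by positivity) (hu.controlled s hs)
  convert this using 1
  rw [weight_rpow hσ hu.nonneg hs.le]
  ring

open BoundedContinuousFunction in
/-- Small solutions exist globally and decay like the heat flow. -/
theorem exists_decayingOrbit (hf : PowerLipschitz f K p)
    (hσ : (n : ℝ) / 2 * (p - 1) = 1 + σ) (hσ0 : 0 < σ) (hM : 0 < M)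
    (hsmall : 4 * 2 ^ ((n : ℝ) / 2) * K * M ^ (p - 1) ≤ σ) {φ : L1Sp n}
    (hφ : Controlled (M / (2 * 2 ^ ((n : ℝ) / 2))) 1 φ) :
    ∃ u : ℝ → L1Sp n, DecayingOrbit M u ∧
      ∀ t, 0 ≤ t → u t = heat n t φ + duhamel (fun s => superpos n f (u s)) t := by
  have hK := hf.nonneg
  have h2 := one_le_two_rpow n
  -- The metric is the uniform `L¹` distance; the `L^∞` decay is only a closed constraint. The
  -- contraction therefore has to be checked in `L¹` only.
  set S : Set (ℝ →ᵇ L1Sp n) :=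
    {U | ∀ t, 0 < t → Controlled M ((1 + t) ^ (-((n : ℝ) / 2))) (U t)} with hS
  have hSclosed : IsClosed S := by
    have : S = ⋂ t, ⋂ _ : 0 < t,
        (fun U : ℝ →ᵇ L1Sp n => U t) ⁻¹' {v | Controlled M ((1 + t) ^ (-((n : ℝ) / 2))) v} := by
      ext U
      simp [hS]
    rw [this]
    exact isClosed_iInter fun t => isClosed_iInter fun _ =>
      (isClosed_setOf_controlled _ _).preimage (continuous_eval_const t)
  have horb : ∀ U : S, DecayingOrbit M (U : ℝ →ᵇ L1Sp n) := fun U =>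
    ⟨U.1.continuous.continuousOn, U.2⟩
  have hsrc := fun U : S => hf.decayingSource hσ hσ0 (horb U)
  set G : S → ℝ → L1Sp n :=
    fun U t => heat n t φ + duhamel (fun s => superpos n f ((U : ℝ →ᵇ L1Sp n) s)) t with hG
  -- The datum accounts for `M/2`, and the smallness of `M` leaves at most `M/2` for the Duhamel
  -- integral.
  have hbound : 2 ^ ((n : ℝ) / 2) * (M / (2 * 2 ^ ((n : ℝ) / 2)) + K * M ^ (p - 1) * M / σ) ≤ M := by
    have e1 : 2 ^ ((n : ℝ) / 2) * (K * M ^ (p - 1) * M / σ) ≤ M / 2 := by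
      rw [← mul_div_assoc, div_le_iff₀ hσ0]
      nlinarith
    rw [mul_add]
    have e2 : (2 : ℝ) ^ ((n : ℝ) / 2) * (M / (2 * 2 ^ ((n : ℝ) / 2))) = M / 2 := by field_simp
    linarith
  have hGc : ∀ U t, 0 ≤ t → Controlled M ((1 + t) ^ (-((n : ℝ) / 2))) (G U t) := by
    intro U t ht
    have := (hφ.heat_decay ht).add ((hsrc U).controlled_duhamel ht)
    rw [← mul_add] at this
    exact this.mono_left hbound (by positivity)
  have hGcont : ∀ U, Continuous fun t => G U (max t 0) := fun U => by
    have : ContinuousOn (G U) (Ici 0) := (continuousOn_heat φ).add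
      (continuousOn_duhamel (hsrc U).continuousOn fun s hs => (hsrc U).controlled_bound hs)
    exact this.comp_continuous (by fun_prop) fun t => mem_Ici.2 (le_max_right _ _)
  -- Composing with `max t 0` freezes the curve at negative times, so that the fixed point is sought
  -- among bounded continuous functions on all of `ℝ`.
  let Φ : S → S := fun U => ⟨BoundedContinuousFunction.ofNormedAddCommGroup
    (fun t => G U (max t 0)) (hGcont U) M fun t => (hGc U _ (le_max_right _ _)).norm_le,
    fun t ht => by
      have := hGc U t ht.le
      rw [← max_eq_left ht.le] at this
      simpa [max_eq_left ht.le] using this⟩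
  have hlip : ∀ U V : S, dist (Φ U) (Φ V) ≤ 1 / 2 * dist U V := by
    intro U V
    refine (BoundedContinuousFunction.dist_le (by positivity)).2 fun t => ?_
    change dist (G U (max t 0)) (G V (max t 0)) ≤ _
    have ht : 0 ≤ max t 0 := le_max_right _ _
    generalize max t 0 = t at ht
    simp only [hG]
    rw [dist_add_left, dist_eq_norm, ← duhamel_sub ht (hsrc U).continuousOn
      (fun s hs => ((hsrc U).controlled_bound hs).norm_le) (hsrc V).continuousOn
      (fun s hs => ((hsrc V).controlled_bound hs).norm_le)]
    have hb := ((integrableOn_one_add_rpow hσ0 le_rfl).const_mul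
      (2 * K * M ^ (p - 1) * dist U V))
    refine (norm_duhamel_le ht (IntegrableOn.mono_set hb (Ioc_subset_Ioi_self (a := t) (b := 0)))
      fun s hs => ?_).trans ?_
    · refine (hf.norm_superpos_sub_le (U.2 s hs.1) (V.2 s hs.1)).trans ?_
      rw [weight_rpow hσ hM.le hs.1.le, ← dist_eq_norm]
      have h3 : dist ((U : ℝ →ᵇ L1Sp n) s) ((V : ℝ →ᵇ L1Sp n) s) ≤ dist U V :=
        BoundedContinuousFunction.dist_coe_le_dist s
      have h4 : 0 ≤ (1 + s) ^ (-(1 + σ)) := by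
        have := hs.1
        positivity
      calc K * (M ^ (p - 1) * (1 + s) ^ (-(1 + σ)) + M ^ (p - 1) * (1 + s) ^ (-(1 + σ))) *
            dist ((U : ℝ →ᵇ L1Sp n) s) ((V : ℝ →ᵇ L1Sp n) s)
          ≤ K * (M ^ (p - 1) * (1 + s) ^ (-(1 + σ)) + M ^ (p - 1) * (1 + s) ^ (-(1 + σ))) *
            dist U V := by gcongr
        _ = _ := by ring
    · have h3 : ∫ s in Ioc 0 t, 2 * K * M ^ (p - 1) * dist U V * (1 + s : ℝ) ^ (-(1 + σ)) ≤
          ∫ s in Ioi 0, 2 * K * M ^ (p - 1) * dist U V * (1 + s : ℝ) ^ (-(1 + σ)) := by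
        refine setIntegral_mono_set hb ?_ (LE.le.eventuallyLE Ioc_subset_Ioi_self)
        filter_upwards [ae_restrict_mem measurableSet_Ioi] with s hs
        have : 0 < s := hs
        simp only [Pi.zero_apply]
        positivity
      refine h3.trans ?_
      rw [integral_const_mul, integral_one_add_rpow hσ0 le_rfl, add_zero, Real.one_rpow,
        mul_one_div, div_le_iff₀ hσ0]
      have h4 : 2 * K * M ^ (p - 1) ≤ 1 / 2 * σ := by
        have : 0 ≤ K * M ^ (p - 1) := by positivity
        nlinarith
      calc 2 * K * M ^ (p - 1) * dist U V ≤ 1 / 2 * σ * dist U V := by gcongr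
        _ = _ := by ring
  have hcontr : ContractingWith (1 / 2) Φ :=
    ⟨by norm_num, LipschitzWith.of_dist_le_mul fun U V => by simpa using hlip U V⟩
  have : CompleteSpace S := hSclosed.completeSpace_coe
  have : Nonempty S := ⟨⟨0, fun t _ => (Controlled.zero _).mono_left hM.le (by positivity)⟩⟩
  obtain ⟨U, hU⟩ : ∃ U, Φ U = U := ⟨_, hcontr.fixedPoint_isFixedPt⟩
  refine ⟨(U : ℝ →ᵇ L1Sp n), horb U, fun t ht => ?_⟩
  conv_lhs => rw [← hU]
  change G U (max t 0) = G U t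
  rw [max_eq_left ht]

end PowerLipschitz

/-! ### Uniqueness by a Gronwall argument. -/

section Uniqueness
variable {n : ℕ}

/-- The maximum `S` of `e^{-rt} d(t)` satisfies `S ≤ (L/r) S`; taking `r = L + 1` makes the factor
less than one, so `S = 0`. -/
theorem eq_zero_of_le_integral {d : ℝ → ℝ} {L T : ℝ} (hT : 0 ≤ T) (hL : 0 ≤ L)
    (hd : ContinuousOn d (Icc 0 T)) (hd0 : ∀ t ∈ Icc 0 T, 0 ≤ d t)
    (h : ∀ t ∈ Icc 0 T, d t ≤ ∫ s in (0 : ℝ)..t, L * d s) : d T = 0 := by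
  set r := L + 1 with hr
  have hr0 : 0 < r := by linarith
  obtain ⟨τ, hτ, hmax⟩ := isCompact_Icc.exists_isMaxOn (nonempty_Icc.2 hT)
    (f := fun t => Real.exp (-(r * t)) * d t) (by fun_prop)
  set S := Real.exp (-(r * τ)) * d τ with hS
  have hS0 : 0 ≤ S := mul_nonneg (Real.exp_pos _).le (hd0 τ hτ)
  have hle : ∀ s ∈ Icc 0 T, d s ≤ S * Real.exp (r * s) := fun s hs => by
    have h1 : Real.exp (-(r * s)) * d s ≤ S := hmax hs
    rw [Real.exp_neg, inv_mul_le_iff₀ (Real.exp_pos _)] at h1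
    linarith
  have hint : ∫ s in (0 : ℝ)..τ, L * (S * Real.exp (r * s)) =
      L * (S * ((Real.exp (r * τ) - 1) / r)) := by
    rw [intervalIntegral.integral_const_mul, intervalIntegral.integral_const_mul,
      intervalIntegral.integral_comp_mul_left _ hr0.ne', integral_exp, mul_zero, Real.exp_zero,
      smul_eq_mul]
    ring
  have hdi : IntervalIntegrable (fun s => L * d s) volume 0 τ := by
    refine ContinuousOn.intervalIntegrable ?_
    rw [uIcc_of_le hτ.1]
    exact (hd.mono (Icc_subset_Icc_right hτ.2)).const_mul _ |>.congr fun _ _ => rfl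
  have h1 : d τ ≤ L * (S * ((Real.exp (r * τ) - 1) / r)) := by
    rw [← hint]
    refine (h τ hτ).trans (intervalIntegral.integral_mono_on hτ.1 hdi
      (Continuous.intervalIntegrable (by fun_prop) _ _) fun s hs => ?_)
    gcongr
    exact hle s ⟨hs.1, hs.2.trans hτ.2⟩
  have h2 : S ≤ L / r * S := by
    have h3 : Real.exp (-(r * τ)) * Real.exp (r * τ) = 1 := by rw [← Real.exp_add]; simp
    have h4 := Real.exp_pos (-(r * τ))
    calc S ≤ Real.exp (-(r * τ)) * (L * (S * ((Real.exp (r * τ) - 1) / r))) := by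
          rw [hS]; gcongr
      _ ≤ Real.exp (-(r * τ)) * (L * (S * (Real.exp (r * τ) / r))) := by gcongr; linarith
      _ = L / r * S * (Real.exp (-(r * τ)) * Real.exp (r * τ)) := by ring
      _ = _ := by rw [h3, mul_one]
  have h3 : L / r < 1 := (div_lt_one hr0).2 (by linarith)
  have h4 : S = 0 := by nlinarith
  have h5 := hle T ⟨hT, le_rfl⟩
  rw [h4, zero_mul] at h5
  exact le_antisymm h5 (hd0 T ⟨hT, le_rfl⟩)

/-- Mild solutions in the solution space are unique. -/
theorem IsMildSolution.eqOn {f : ℝ → ℝ} {K p : ℝ} (hf : PowerLipschitz f K p) {φ : L1Sp n}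
    {u v : ℝ → L1Sp n} (hu : MemX n u) (hv : MemX n v) (hum : IsMildSolution n f φ u)
    (hvm : IsMildSolution n f φ v) : EqOn v u (Ici 0) := by
  obtain ⟨M₁, hM₁⟩ := hu.exists_controlled
  obtain ⟨M₂, hM₂⟩ := hv.exists_controlled
  have hK := hf.nonneg
  have hMn₁ := (hM₁ 1 one_pos).nonneg
  have hMn₂ := (hM₂ 1 one_pos).nonneg
  set L := K * ((M₁ * 1) ^ (p - 1) + (M₂ * 1) ^ (p - 1)) with hL
  have hL0 : 0 ≤ L := by positivity
  have hcu := hu.1.1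
  have hcv := hv.1.1
  have hsu := hf.continuousOn_superpos (hcu.mono Ioi_subset_Ici_self) fun s hs => hM₁ s hs
  have hsv := hf.continuousOn_superpos (hcv.mono Ioi_subset_Ici_self) fun s hs => hM₂ s hs
  have hbu := fun s (hs : 0 < s) => (hf.controlled_superpos zero_le_one (hM₁ s hs)).norm_le
  have hbv := fun s (hs : 0 < s) => (hf.controlled_superpos zero_le_one (hM₂ s hs)).norm_le
  intro T hT
  have hd : ContinuousOn (fun t => ‖u t - v t‖) (Ici 0) := (hcu.sub hcv).norm
  have key := eq_zero_of_le_integral (d := fun t => ‖u t - v t‖) (mem_Ici.1 hT) hL0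
    (hd.mono Icc_subset_Ici_self) (fun _ _ => norm_nonneg _) fun t ht => by
      have h1 : u t - v t =
          duhamel (fun s => superpos n f (u s) - superpos n f (v s)) t := by
        rw [duhamel_sub ht.1 hsu hbu hsv hbv, (hum t ht.1).2, (hvm t ht.1).2, duhamel, duhamel]
        abel
      rw [h1, intervalIntegral.integral_of_le ht.1]
      refine norm_duhamel_le ht.1 ?_ fun s hs =>
        hf.norm_superpos_sub_le (hM₁ s hs.1) (hM₂ s hs.1)
      refine ((hd.mono Icc_subset_Ici_self).const_mul L |>.integrableOn_Icc).mono_set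
        Ioc_subset_Icc_self
  exact (sub_eq_zero.1 (norm_eq_zero.1 key)).symm

end Uniqueness

/-! ### Membership in the solution space and uniform decay. -/

section Profile
variable {n : ℕ} {F : ℝ → L1Sp n} {φ : L1Sp n} {A B a : ℝ} {u : ℝ → L1Sp n}

theorem DecayingSource.controlled_heat_add_duhamel (hF : DecayingSource A a F)
    (hφ : Controlled B 1 φ) {t : ℝ} (ht : 0 ≤ t) :
    Controlled (2 ^ ((n : ℝ) / 2) * (B + A / a)) ((1 + t) ^ (-((n : ℝ) / 2)))
      (heat n t φ + duhamel F t) := by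
  rw [mul_add]
  exact (hφ.heat_decay ht).add (hF.controlled_duhamel ht)

open Filter Topology in
theorem DecayingSource.memX (hF : DecayingSource A a F) (hφ : Controlled B 1 φ)
    (hu : ∀ t, 0 ≤ t → u t = heat n t φ + duhamel F t) : MemX n u := by
  have hB : ∀ s, 0 < s → Controlled A 1 (F s) := fun s hs => hF.controlled_bound hs
  refine memX_of_controlled (M := 2 ^ ((n : ℝ) / 2) * (B + A / a)) ?_ (fun t ht => ?_)
    fun t₀ ht₀ => ⟨fun t => gaussLip n * √(|t - t₀| / min t t₀) * B + duhamelModulus n A t t₀,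
      ?_, fun t ht => ?_⟩
  · exact ((continuousOn_heat φ).add (continuousOn_duhamel hF.continuousOn hB)).congr hu
  · rw [hu t ht]
    exact (hF.controlled_heat_add_duhamel hφ ht).mono_right
      (one_add_rpow_le_one (by positivity) ht)
  · have hc : ContinuousAt (fun t => gaussLip n * √(|t - t₀| / min t t₀) * B) t₀ := by
      refine ((ContinuousAt.sqrt (ContinuousAt.div ?_ ?_ ?_)).const_mul _).mul_const _
      · fun_prop
      · fun_prop
      · simpa using ht₀.ne'
    have hc' : Tendsto (fun t => gaussLip n * √(|t - t₀| / min t t₀) * B) (𝓝 t₀) (𝓝 0) := by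
      simpa [ContinuousAt] using hc
    simpa using hc'.add (tendsto_duhamelModulus n A t₀)
  · rw [hu t ht.le, hu t₀ ht₀.le, add_sub_add_comm]
    exact (hφ.heat_sub_heat zero_le_one ht ht₀).add
      (controlled_duhamel_sub_duhamel zero_le_one hF.continuousOn hB ht.le ht₀.le)

theorem DecayingSource.uniformDecay (hF : DecayingSource A a F) (hφ : Controlled B 1 φ)
    (hu : ∀ t, 0 ≤ t → u t = heat n t φ + duhamel F t) : UniformDecay n u := by
  refine ⟨2 ^ ((n : ℝ) / 2) * (B + A / a), fun q hq t ht => ?_⟩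
  rw [hu t ht]
  have ht1 : 0 < 1 + t := by linarith
  have h := (hF.controlled_heat_add_duhamel hφ ht).eLpNorm_le (by positivity) hq
  refine (mul_le_mul_right h _).trans ?_
  rw [← ENNReal.ofReal_mul (by positivity), ← Real.rpow_mul ht1.le, mul_left_comm,
    ← Real.rpow_add ht1]
  simp

end Profile

/-! ### The successive approximations and their errors. -/

namespace PowerLipschitz
variable {n : ℕ} {f : ℝ → ℝ} {K p σ M B : ℝ} {φ : L1Sp n} {u : ℝ → L1Sp n}

/-- The recursion for the approximations, including the first one. -/
theorem approx_succ (hf : PowerLipschitz f K p) (φ : L1Sp n) (u : ℝ → L1Sp n) (N : ℕ) :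
    approx n f φ u (N + 1) = fun t => heat n t (nextDatum n f φ u (approx n f φ u N)) +
      duhamel (fun s => superpos n f (approx n f φ u N s)) t := by
  cases N with
  | zero =>
    funext t
    simp [approx, nextDatum, firstDatum, duhamel, hf.superpos_zero, heat_zero]
  | succ N => rfl

/-- The error of the `N`-th approximation decays at every rate `b < 1` with `b ≤ Nσ`. -/
def ApproxError (f : ℝ → ℝ) (φ : L1Sp n) (u : ℝ → L1Sp n) (σ : ℝ) (N : ℕ) : Prop :=
  (∃ M, DecayingOrbit M (approx n f φ u N)) ∧
    ∀ b : ℝ, 0 ≤ b → b < 1 → b ≤ N * σ → ∃ C, ∀ s, 0 < s →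
      Controlled (C * (1 + s) ^ (-b)) ((1 + s) ^ (-((n : ℝ) / 2))) (u s - approx n f φ u N s)

/-- The exponent `a` need not equal `(N+1)σ`, because the recorded errors stop short of `b = 1`.
Only the rate function matters, and all exponents above one share the same rate. -/
theorem ApproxError.exists_decayingSource {N : ℕ} (hN : ApproxError f φ u σ N)
    (hf : PowerLipschitz f K p) (hσ : (n : ℝ) / 2 * (p - 1) = 1 + σ) (hσ0 : 0 < σ)
    (hu : DecayingOrbit M u) :
    ∃ A a, DecayingSource A a
        (fun s => superpos n f (u s) - superpos n f (approx n f φ u N s)) ∧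
      decayRate a = decayRate ((N + 1 : ℕ) * σ) := by
  obtain ⟨⟨M', hM'⟩, herr⟩ := hN
  have main : ∀ b, 0 ≤ b → b < 1 → b ≤ N * σ → ∃ A, DecayingSource A (σ + b)
      (fun s => superpos n f (u s) - superpos n f (approx n f φ u N s)) := by
    intro b hb0 hb1 hb
    obtain ⟨C, hC⟩ := herr b hb0 hb1 hb
    exact ⟨_, hf.decayingSource_sub hσ (by linarith) (hu.mono (le_max_left M M'))
      (hM'.mono (le_max_right M M')) hC⟩
  have hcast : ((N + 1 : ℕ) : ℝ) * σ = σ + N * σ := by push_cast; ring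
  have hNσ : 0 ≤ N * σ := by positivity
  rcases lt_or_ge (N * σ) 1 with h | h
  · obtain ⟨A, hA⟩ := main (N * σ) hNσ h le_rfl
    exact ⟨A, _, hA, by rw [hcast]⟩
  -- Past saturation any `b` in `[0,1)` with `σ + b > 1` will do; `1 - σ/2` is such a value once
  -- made nonnegative.
  · have hb1 : max 0 (1 - σ / 2) < 1 := max_lt one_pos (by linarith)
    obtain ⟨A, hA⟩ := main (max 0 (1 - σ / 2)) (le_max_left _ _) hb1 (hb1.le.trans h)
    refine ⟨A, _, hA, ?_⟩
    have h1 : 1 < σ + max 0 (1 - σ / 2) := by linarith [le_max_right 0 (1 - σ / 2)]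
    have h2 : 1 < ((N + 1 : ℕ) : ℝ) * σ := by rw [hcast]; linarith
    funext t
    rw [decayRate, if_neg h1.not_gt, if_neg h1.ne', decayRate, if_neg h2.not_gt, if_neg h2.ne']

/-- The terms in `φ` cancel. What remains of the difference is the Duhamel integral of `f(u) -
f(u_N)` minus the heat flow of its total mass, to which the large-time estimate applies. -/
theorem ApproxError.exists_controlled {N : ℕ} (hN : ApproxError f φ u σ N)
    (hf : PowerLipschitz f K p) (hσ : (n : ℝ) / 2 * (p - 1) = 1 + σ) (hσ0 : 0 < σ)
    (hu : DecayingOrbit M u)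
    (hmild : ∀ t, 0 ≤ t → u t = heat n t φ + duhamel (fun s => superpos n f (u s)) t) :
    ∃ C, 0 < C ∧ ∀ t, 1 ≤ t → Controlled (C * decayRate ((N + 1 : ℕ) * σ) t)
      (t ^ (-((n : ℝ) / 2))) (u t - approx n f φ u (N + 1) t) := by
  obtain ⟨A, a, hA, hrate⟩ := hN.exists_decayingSource hf hσ hσ0 hu
  obtain ⟨⟨M', hM'⟩, -⟩ := hN
  obtain ⟨C, hC, hmass⟩ := sourceMass_le hA.pos
  have hA0 := hA.nonneg
  have hg := gaussLip_ge n
  refine ⟨2 ^ ((n : ℝ) / 2) * (gaussLip n * A * C) + 1, by positivity, fun t ht => ?_⟩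
  have ht0 : 0 < t := by linarith
  have hs1 := hf.decayingSource hσ hσ0 hu
  have hs2 := hf.decayingSource hσ hσ0 hM'
  have hdiff : u t - approx n f φ u (N + 1) t =
      duhamel (fun s => superpos n f (u s) - superpos n f (approx n f φ u N s)) t -
        heat n t (∫ s in Ioi 0, (superpos n f (u s) - superpos n f (approx n f φ u N s))) := by
    rw [hf.approx_succ, hmild t ht0.le, duhamel_sub ht0.le hs1.continuousOn
      (fun s hs => (hs1.controlled_bound hs).norm_le) hs2.continuousOn
      (fun s hs => (hs2.controlled_bound hs).norm_le)]
    simp only [nextDatum, heat_add]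
    abel
  rw [hdiff]
  have hd : 0 ≤ decayRate ((N + 1 : ℕ) * σ) t := decayRate_nonneg ht
  refine (hA.controlled_duhamel_sub_heat ht0).of_mul_right (one_le_two_rpow n)
    |>.mono_left ?_ (by positivity)
  have h1 := hmass t ht
  rw [hrate] at h1
  calc 2 ^ ((n : ℝ) / 2) * (gaussLip n * A * sourceMass a t)
      ≤ 2 ^ ((n : ℝ) / 2) * (gaussLip n * A * (C * decayRate ((N + 1 : ℕ) * σ) t)) := by gcongr
    _ = 2 ^ ((n : ℝ) / 2) * (gaussLip n * A * C) * decayRate ((N + 1 : ℕ) * σ) t := by ring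
    _ ≤ _ := by
      gcongr
      linarith

/-- The sharp rate of the next error, valid for `t ≥ 1`, is relaxed to a power `b < 1` and extended
to small times by the boundedness of both orbits. -/
theorem approxError (hf : PowerLipschitz f K p) (hσ : (n : ℝ) / 2 * (p - 1) = 1 + σ)
    (hσ0 : 0 < σ) (hφ : Controlled B 1 φ) (hu : DecayingOrbit M u)
    (hmild : ∀ t, 0 ≤ t → u t = heat n t φ + duhamel (fun s => superpos n f (u s)) t) (N : ℕ) :
    ApproxError f φ u σ N := by
  induction N with
  | zero =>
    refine ⟨⟨0, DecayingOrbit.zero⟩, fun b hb0 _ hb => ⟨M, fun s hs => ?_⟩⟩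
    -- With `u₀ = 0` the error is `u` itself, and `b ≤ 0 · σ` asks for no decay beyond that of the
    -- orbit.
    obtain rfl : b = 0 := le_antisymm (by simpa using hb) hb0
    simpa [approx] using hu.controlled s hs
  | succ N ih =>
    obtain ⟨C, hC, hasymp⟩ := ih.exists_controlled hf hσ hσ0 hu hmild
    obtain ⟨A, a, hA, -⟩ := ih.exists_decayingSource hf hσ hσ0 hu
    obtain ⟨⟨M', hM'⟩, -⟩ := ih
    have hdat : Controlled (B + A / a) 1 (nextDatum n f φ u (approx n f φ u N)) :=
      hφ.add hA.controlled_integral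
    have horb := DecayingOrbit.heat_add_duhamel hdat (hf.decayingSource hσ hσ0 hM')
    rw [← hf.approx_succ φ u N] at horb
    refine ⟨⟨_, horb⟩, fun b hb0 hb1 hb => ?_⟩
    obtain ⟨C', hC', hrate⟩ := decayRate_le_rpow hb hb1
    set M₂ := 2 ^ ((n : ℝ) / 2) * (B + A / a + K * M' ^ (p - 1) * M' / σ)
    have hMM : 0 ≤ M + M₂ := add_nonneg hu.nonneg horb.nonneg
    refine ⟨2 ^ ((n : ℝ) / 2) * (C * C') + 2 * (M + M₂), fun t ht => ?_⟩
    rcases le_total 1 t with h1 | h1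
    · have h2 := (hasymp t h1).mono_right (rpow_neg_le_two_rpow_mul (n := n) (y := 1 + t) ht
        (by linarith) (by linarith))
      refine (h2.of_mul_right (one_le_two_rpow n)).mono_left ?_ (by positivity)
      calc 2 ^ ((n : ℝ) / 2) * (C * decayRate ((N + 1 : ℕ) * σ) t)
          ≤ 2 ^ ((n : ℝ) / 2) * (C * (C' * (1 + t) ^ (-b))) := by
            gcongr
            exact hrate t h1
        _ = 2 ^ ((n : ℝ) / 2) * (C * C') * (1 + t) ^ (-b) := by ring
        _ ≤ _ := by
            gcongr
            linarith
    · refine ((hu.controlled t ht).sub (horb.controlled t ht)).mono_left ?_ (by positivity)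
      -- For `t ≤ 1` and `b < 1` the weight is at least `1/2`, which explains the factor `2` in the
      -- constant.
      have h2 : (1 : ℝ) / 2 ≤ (1 + t) ^ (-b) := by
        calc (1 : ℝ) / 2 ≤ (1 + t) ^ (-1 : ℝ) := by
              rw [Real.rpow_neg_one, one_div]
              gcongr
              linarith
          _ ≤ _ := Real.rpow_le_rpow_of_exponent_le (by linarith) (by linarith)
      calc M + M₂ = 2 * (M + M₂) * (1 / 2) := by ring
        _ ≤ 2 * (M + M₂) * (1 + t) ^ (-b) := by gcongr
        _ ≤ _ := by
            gcongr
            have : 0 ≤ 2 ^ ((n : ℝ) / 2) * (C * C') := by positivity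
            linarith

theorem approxWellDefined (hf : PowerLipschitz f K p) (hσ : (n : ℝ) / 2 * (p - 1) = 1 + σ)
    (hσ0 : 0 < σ) (hu : DecayingOrbit M u) (happ : ∀ N, ApproxError f φ u σ N) :
    ApproxWellDefined n f φ u := by
  refine ⟨(hf.decayingSource hσ hσ0 hu).integrableOn, fun N _ => ?_⟩
  obtain ⟨M', hM'⟩ := (happ N).1
  obtain ⟨A, a, hA, -⟩ := (happ N).exists_decayingSource hf hσ hσ0 hu
  exact ⟨fun t ht => (hM'.controlled t ht).memLp_top, hA.integrableOn,
    fun t ht => (hf.decayingSource hσ hσ0 hM').intervalIntegrable ht.le⟩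

end PowerLipschitz

/-! ### The main theorem. -/

theorem theorem1p3 (n : ℕ) (hn : 1 ≤ n) (p : ℝ) (hp : 1 + 2 / (n : ℝ) < p)
    (K : ℝ) (hK : 0 < K) (f : ℝ → ℝ) (hf0 : f 0 = 0)
    (hf : ∀ ξ η : ℝ, |f ξ - f η| ≤ K * (|ξ| ^ (p - 1) + |η| ^ (p - 1)) * |ξ - η|) :
    ∃ ε₀ : ℝ, 0 < ε₀ ∧
      ∀ φ : L1Sp n, eLpNorm φ 1 volume + eLpNorm φ ⊤ volume ≤ ENNReal.ofReal ε₀ →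
        ∃ u : ℝ → L1Sp n,
          MemX n u ∧ IsMildSolution n f φ u ∧
          (∀ v : ℝ → L1Sp n, MemX n v → IsMildSolution n f φ v → EqOn v u (Ici 0)) ∧
          UniformDecay n u ∧
          ApproxWellDefined n f φ u ∧
          ∀ σ : ℝ, σ = (n : ℝ) / 2 * (p - 1) - 1 →
            0 < σ ∧
            ∀ N : ℕ, 1 ≤ N → ∀ q : ENNReal, 1 ≤ q →
              ∃ C : ℝ, 0 < C ∧ ∀ t : ℝ, (2 : ℝ) ^ (N - 1) < t →
                ENNReal.ofReal (t ^ ((n : ℝ) / 2 * (1 - q⁻¹.toReal))) *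
                    eLpNorm (u t - approx n f φ u N t) q volume
                  ≤ ENNReal.ofReal (C * decayRate (N * σ) t) := by
  have hn0 : (0 : ℝ) < n := by exact_mod_cast hn
  have hσ0 : 0 < (n : ℝ) / 2 * (p - 1) - 1 := by
    have h1 : 2 / (n : ℝ) < p - 1 := by linarith
    rw [div_lt_iff₀ hn0] at h1
    linarith
  have hp1 : 1 < p := by
    have : 0 < 2 / (n : ℝ) := by positivity
    linarith
  have hpl : PowerLipschitz f K p := ⟨hp1, hK.le, hf0, hf⟩
  have h2 := one_le_two_rpow n
  -- This is the largest radius allowed by the smallness condition, which it satisfies with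
  -- equality.
  set M : ℝ := (((n : ℝ) / 2 * (p - 1) - 1) / (4 * 2 ^ ((n : ℝ) / 2) * K)) ^ (p - 1)⁻¹ with hM
  have hM0 : 0 < M := by positivity
  have hMp : 4 * 2 ^ ((n : ℝ) / 2) * K * M ^ (p - 1) ≤ (n : ℝ) / 2 * (p - 1) - 1 := by
    rw [hM, Real.rpow_inv_rpow (by positivity) (by linarith), mul_div_cancel₀ _ (by positivity)]
  refine ⟨M / (2 * 2 ^ ((n : ℝ) / 2)), by positivity, fun φ hφ => ?_⟩
  have hφc := controlled_of_eLpNorm_le (by positivity) hφ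
  have hσ : (n : ℝ) / 2 * (p - 1) = 1 + ((n : ℝ) / 2 * (p - 1) - 1) := by ring
  obtain ⟨u, hu, hmild⟩ := hpl.exists_decayingOrbit hσ hσ0 hM0 hMp hφc
  have hsrc := hpl.decayingSource hσ hσ0 hu
  have hX := hsrc.memX hφc hmild
  have hsol : IsMildSolution n f φ u := fun t ht => ⟨hsrc.intervalIntegrable ht, hmild t ht⟩
  have happ := hpl.approxError hσ hσ0 hφc hu hmild
  refine ⟨u, hX, hsol, fun v hv hvm => hsol.eqOn hpl hX hv hvm, hsrc.uniformDecay hφc hmild,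
    hpl.approxWellDefined hσ hσ0 hu happ, fun σ hσ' => ⟨hσ' ▸ hσ0, fun N hN q hq => ?_⟩⟩
  subst hσ'
  obtain ⟨N, rfl⟩ := Nat.exists_eq_add_of_le' hN
  obtain ⟨C, hC, hasymp⟩ := (happ N).exists_controlled hpl hσ hσ0 hu hmild
  refine ⟨C, hC, fun t ht => ?_⟩
  -- The threshold `2^{N-1}` enters only through being at least one; the estimate holds from `t = 1`
  -- on for every `N`.
  have ht1 : 1 ≤ t := (one_le_pow₀ one_le_two).trans ht.le
  have ht0 : 0 < t := by linarith
  have h := (hasymp t ht1).eLpNorm_le (by positivity) hq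
  refine (mul_le_mul_right h _).trans ?_
  rw [← ENNReal.ofReal_mul (by positivity), ← Real.rpow_mul ht0.le, mul_left_comm,
    ← Real.rpow_add ht0]
  simp
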